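/- **Setting.** A Gauss paragraph $p=(v_1,\dots,v_N)$, $N\ge 1$, in a finite alphabet $E$ is a sequence of nonempty cyclic words such that every letter occurs exactly twice in total and the words cannot be split into two nonempty families without common letters. A letter is a double (single) letter of a word if it occurs twice (once) in it. For a double letter $i$ of $w=i\,x_1\,i\,x_2$, the $p$-sets $p_i,p_i'$ are the sets of letters occurring exactly once in $x_1$, respectively in $x_2$, and $w_i$ is the set of letters $j\neq i$ interlaced with $i$ in $w$ ($w=i\cdots j\cdots i\cdots j\cdots$). A word-wise partition $P=(A_1\cup A_1',\dots,A_N\cup A_N')$ is a partition of $E$ into $2N$ disjoint, possibly empty sets $A_n,A_n'$ such that all double letters of $v_n$ lie in $A_n\cup A_n'$, and whenever $v_m,v_n$ ($m\ne n$) have $2k$ letters in common, $k$ of these lie in $A_m\cup A_m'$ and $k$ in $A_n\cup A_n'$. Suppose that $(p,P)$ satisfies: * (i) $\#(w_i)\equiv\#(p_i)\equiv\#(p_i')\equiv 0 \pmod 2$ for every double letter $i$ of a word $w$; * (iii) any two different words have an even number of letters in common; * (v) $P$ is compatible with $p$: if $i,j$ are interlaced in $w=i\,x_1\,j\,x_2\,i\,x_3\,j\,x_4$,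 then $\#(w_i\cap w_j)+s(x_1)\equiv\#(w_i\cap w_j)+s(x_3)\pmod 2$, where $s(x)$ is the number of single letters of $w$ in $x$; and if $i\ne j$ are single letters of $w=v_n=i\,x_1\,j\,x_2$ lying in $A_n\cup A_n'$, then the lengths satisfy $\ell(x_1)\equiv\ell(x_2)\pmod 2$; in both cases the common value is $1$ mod $2$ if $i,j$ lie in the same set of $P$, and $0$ if they lie in different sets. Let $\alpha$ be a virtual string with underlying Gauss paragraph $p$ and induced word-wise partition $P$. That is, $\alpha$ has oriented core circles $S_1,\dots,S_N$, the positions of $v_n$ being distinguished points in cyclic order on $S_n$, and for every $i\in E$ an arrow $e_i=(a_i,b_i)$ (tail $a_i$, head $b_i$) formed by the two points with letter $i$; $A_n\cup A_n'$ is the set of letters whose arrows have their tails on $S_n$, and two such letters $i,j$ lie in the same one of the sets $A_n,A_n'$ if and only if the number of arrowheads minus the number of arrowtails on the half-open arc $a_ia_j\setminus\{a_i\}$ of $S_n$ is even. Let $\Sigma_\alpha$ be the canonical surface: the compact connected oriented surface obtained from the $4$-valent graph $\alpha/(a_i\sim b_i)$ by thickening its vertices to discs and its edges to orientation-compatible ribbons,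 so that the image of the core circles is a generic closed curve $\rho_\alpha:\coprod_n S_n\to\Sigma_\alpha$ whose branches at $a_i$ and $b_i$ form, in this order, a positive basis at the crossing $i$. Write $[S_n]=[\rho_\alpha(S_n)]$ and, for a double letter $i$, let $[e_i]=[\rho_\alpha(a_ib_i)]$ be the class of the loop given by the positively oriented arc from $a_i$ to $b_i$. A cyclic sequence $d$ consists of $M\ge 2$ positively oriented arcs on $M$ different core circles (at most one arc on each circle), arranged cyclically so that the end of each arc and the beginning of the next one carry the same letter; $[C_d]$ is the class of the loop which is the union of the images of the arcs. Let $G_p$ be the multigraph with the words as vertices and the letters as edges, the letter $i$ joining the words in which it occurs. For the edge set $T$ of a spanning tree of $G_p$ and a letter $i\notin T$ that is a single letter of two words, a cyclic sequence $d$ is associated to $i$ if it passes $e_i$ from its tail to its head and all the other letters at which it passes from one arc to the next belong to $T$. **Lemma.** $H_1(\Sigma_\alpha;\mathbb Z)$ is a nontrivial free abelian group. The graph $G_p$ has a spanning tree; and for every spanning tree of $G_p$, with edge set $T$, every single letter $i\notin T$ has an associated cyclic sequence, and for any choice of a cyclic sequence $d_i$ associated to each such $i$, the family consisting of $$[S_n]\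 (1\le n\le N),\qquad [e_i]\ (i\text{ a double letter of a word of }p),\qquad [C_{d_i}]\ (i\notin T\text{ a single letter of words of }p)$$ is a basis of $H_1(\Sigma_\alpha;\mathbb Z)$. -/

import Mathlib

noncomputable section

open CategoryTheory

/-! ### First singular homology with integer coefficients -/

/-- The complex of singular chains of `X` with integer coefficients. -/
abbrev singularChains (X : Type) [TopologicalSpace X] : ChainComplex (ModuleCat.{0} ℤ) ℕ :=
  ((AlgebraicTopology.singularChainComplexFunctor (ModuleCat.{0} ℤ)).obj
    (ModuleCat.of ℤ ℤ)).obj (TopCat.of X)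

/-- The first singular homology group `H₁(X; ℤ)`. -/
abbrev H1 (X : Type) [TopologicalSpace X] : ModuleCat.{0} ℤ :=
  ((AlgebraicTopology.singularHomologyFunctor (ModuleCat.{0} ℤ) 1).obj
    (ModuleCat.of ℤ ℤ)).obj (TopCat.of X)

section SingularChains

variable {X : Type} [TopologicalSpace X]

/-- The singular 0-chain given by a point (the chain `c` is encoded by the linear map
`ℤ → C₀(X)` which sends `1` to `c`). -/
def pointChain (x : X) : ModuleCat.of ℤ ℤ ⟶ (singularChains X).X 0 :=
  (TopCat.toSSet.obj (TopCat.of X)).ιChainComplex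
    ((TopCat.toSSetObj₀Equiv (X := TopCat.of X)).symm x)

/-- The singular 1-chain given by a path, considered as a singular 1-simplex. -/
def pathChain {x y : X} (γ : Path x y) : ModuleCat.of ℤ ℤ ⟶ (singularChains X).X 1 :=
  (TopCat.toSSet.obj (TopCat.of X)).ιChainComplex
    ((TopCat.toSSetObj₁Equiv (X := TopCat.of X)).symm
      ((TopCat.pathEquiv (X := TopCat.of X)).symm γ).hom)

/-- The boundary of a path is its end point minus its starting point. -/
theorem pathChain_d {x y : X} (γ : Path x y) :
    pathChain γ ≫ (singularChains X).d 1 0 = pointChain y - pointChain x := by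
  have h := (TopCat.toSSet.obj (TopCat.of X)).ιChainComplex_d (R := ModuleCat.of ℤ ℤ)
    ((TopCat.toSSetObj₁Equiv (X := TopCat.of X)).symm
      ((TopCat.pathEquiv (X := TopCat.of X)).symm γ).hom)
  refine h.trans ?_
  rw [Fin.sum_univ_two, TopCat.δ_zero_toSSetObj₁Equiv.symm, TopCat.δ_one_toSSetObj₁Equiv.symm,
    TopCat.Path.hom₀, TopCat.Path.hom₁]
  simp only [Fin.val_zero, Fin.val_one, pow_zero, pow_one, one_smul, neg_smul]
  exact (sub_eq_add_neg _ _).symm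

/-- The homology class of a singular 1-cycle. -/
def cycleClass (c : ModuleCat.of ℤ ℤ ⟶ (singularChains X).X 1)
    (hc : c ≫ (singularChains X).d 1 0 = 0) : H1 X :=
  ((singularChains X).liftCycles c 0 (by simp) hc ≫ (singularChains X).homologyπ 1).hom (1 : ℤ)

end SingularChains

/-! ### Gauss paragraphs -/

/-- A Gauss paragraph with words `v_n`, `n : Fin N`, in the alphabet `E`. The word `v_n` has
`len n ≥ 1` entries, which are indexed cyclically by `ZMod (len n)`. -/
structure GaussParagraph (E : Type) (N : ℕ) where
  pos_N : 0 < N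
  len : Fin N → ℕ
  len_pos : ∀ n, 0 < len n
  letter : (Σ n, ZMod (len n)) → E
  /-- Every letter occurs exactly twice. -/
  twice : ∀ i, {x | letter x = i}.ncard = 2
  /-- The words cannot be partitioned into two sets with no letters in common. -/
  connected : ∀ W : Set (Fin N), W.Nonempty → Wᶜ.Nonempty →
    ∃ x y, letter x = letter y ∧ x.1 ∈ W ∧ y.1 ∈ Wᶜ

namespace GaussParagraph

variable {E : Type} {N : ℕ} (p : GaussParagraph E N)

/-- The positions in the words of `p`. -/
abbrev Pos : Type := Σ n, ZMod (p.len n)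

instance (n : Fin N) : NeZero (p.len n) := ⟨(p.len_pos n).ne'⟩

/-- The letter at position `k` of the word `v_n`. -/
abbrev entry (n : Fin N) (k : ZMod (p.len n)) : E := p.letter ⟨n, k⟩

/-- The number of occurrences of `i` in the word `v_n`. -/
def count (n : Fin N) (i : E) : ℕ := {k | p.entry n k = i}.ncard

/-- `i` is a single letter of the word `v_n`. -/
def IsSingle (n : Fin N) (i : E) : Prop := p.count n i = 1

/-- `i` is a double letter of the word `v_n`. -/
def IsDouble (n : Fin N) (i : E) : Prop := p.count n i = 2

/-- The positions strictly between `a` and `b` in the word `v_n`, going forward from `a`. -/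
def openArc (n : Fin N) (a b : ZMod (p.len n)) : Set (ZMod (p.len n)) :=
  {x | 0 < (x - a).val ∧ (x - a).val < (b - a).val}

/-- The letters which occur exactly once strictly between the positions `a` and `b` of `v_n`.
If `a ≠ b` are the two positions of a double letter `i`, then `p.between n a b` and
`p.between n b a` are the two p-sets of `i`. -/
def between (n : Fin N) (a b : ZMod (p.len n)) : Set E :=
  {j | {x | x ∈ p.openArc n a b ∧ p.entry n x = j}.ncard = 1}

/-- `i` and `j` are interlaced in the word `v_n`. -/
def Interlaced (n : Fin N) (i j : E) : Prop :=
  i ≠ j ∧ ∃ a c b d, p.entry n a = i ∧ p.entry n c = j ∧ p.entry n b = i ∧ p.entry n d = j ∧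
    c ∈ p.openArc n a b ∧ d ∈ p.openArc n b a

/-- The set `w_i` of letters interlaced with `i` in the word `w = v_n`. -/
def interlacedWith (n : Fin N) (i : E) : Set E := {j | p.Interlaced n i j}

/-- The number of (occurrences of) single letters of `v_n` strictly between `a` and `b`. -/
def singlesBetween (n : Fin N) (a b : ZMod (p.len n)) : ℕ :=
  {x | x ∈ p.openArc n a b ∧ p.IsSingle n (p.entry n x)}.ncard

/-- The letters which two words have in common. -/
def common (m n : Fin N) : Set E := {i | (∃ k, p.entry m k = i) ∧ ∃ k, p.entry n k = i}

/-- A word-wise partition `(A 1 ∪ A' 1, …, A N ∪ A' N)` of the alphabet. -/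
structure WordwisePartition where
  A : Fin N → Set E
  A' : Fin N → Set E
  /-- Every letter belongs to exactly one of the sets. -/
  partition : ∀ i, ∃! s : Fin N × Bool, i ∈ (if s.2 then A s.1 else A' s.1)
  double : ∀ n i, p.IsDouble n i → i ∈ A n ∪ A' n
  common : ∀ m n, m ≠ n → ∀ k, (p.common m n).ncard = 2 * k →
    (p.common m n ∩ (A m ∪ A' m)).ncard = k ∧ (p.common m n ∩ (A n ∪ A' n)).ncard = k

variable {p} in
/-- `i` and `j` belong to the same set of the partition. -/
def WordwisePartition.Same (P : p.WordwisePartition) (i j : E) : Prop :=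
  ∃ n, (i ∈ P.A n ∧ j ∈ P.A n) ∨ (i ∈ P.A' n ∧ j ∈ P.A' n)

variable {p} in
/-- The partition `P` is compatible with `p`. -/
structure WordwisePartition.Compatible (P : p.WordwisePartition) : Prop where
  /-- The condition for interlaced letters, `v_n = i x₁ j x₂ i x₃ j x₄`. -/
  interlaced : ∀ n (a c b d : ZMod (p.len n)), p.entry n a = p.entry n b → p.entry n c = p.entry n d →
    p.Interlaced n (p.entry n a) (p.entry n c) → c ∈ p.openArc n a b → d ∈ p.openArc n b a →
    let w := (p.interlacedWith n (p.entry n a) ∩ p.interlacedWith n (p.entry n c)).ncard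
    w + p.singlesBetween n a c ≡ w + p.singlesBetween n b d [MOD 2] ∧
    (¬ P.Same (p.entry n a) (p.entry n c) → w + p.singlesBetween n b d ≡ 0 [MOD 2]) ∧
    (P.Same (p.entry n a) (p.entry n c) → w + p.singlesBetween n b d ≡ 1 [MOD 2])
  /-- The condition for single letters, `v_n = i x₁ j x₂`. -/
  single : ∀ n (a b : ZMod (p.len n)), a ≠ b → p.IsSingle n (p.entry n a) →
    p.IsSingle n (p.entry n b) → p.entry n a ∈ P.A n ∪ P.A' n → p.entry n b ∈ P.A n ∪ P.A' n →
    (p.openArc n a b).ncard ≡ (p.openArc n b a).ncard [MOD 2] ∧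
    (¬ P.Same (p.entry n a) (p.entry n b) → (p.openArc n b a).ncard ≡ 0 [MOD 2]) ∧
    (P.Same (p.entry n a) (p.entry n b) → (p.openArc n b a).ncard ≡ 1 [MOD 2])

/-- For every double letter `i` of a word `w`, the set `w_i` and the two p-sets of `i` have an
even number of elements. -/
def EvenPSets : Prop :=
  ∀ n (a b : ZMod (p.len n)), a ≠ b → p.entry n a = p.entry n b →
    Even (p.interlacedWith n (p.entry n a)).ncard ∧
    Even (p.between n a b).ncard ∧ Even (p.between n b a).ncard

/-- Any two words have an even number of letters in common. -/
def EvenCommon : Prop := ∀ m n, m ≠ n → Even (p.common m n).ncard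

theorem eq_or_eq_of_letter {x y z : p.Pos} (hxy : x ≠ y) (h : p.letter x = p.letter y)
    (hz : p.letter z = p.letter y) : z = x ∨ z = y := by
  obtain ⟨u, v, -, huv⟩ := Set.ncard_eq_two.1 (p.twice (p.letter y))
  have hx : x ∈ {x | p.letter x = p.letter y} := h
  have hy : y ∈ {x | p.letter x = p.letter y} := rfl
  have hz' : z ∈ {x | p.letter x = p.letter y} := hz
  rw [huv] at hx hy hz'
  simp only [Set.mem_insert_iff, Set.mem_singleton_iff] at hx hy hz'
  grind

/-- The graph whose vertices are the words and whose edges are the letters; the ends of the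
edge `i` are the words in which `i` occurs. -/
def wordGraph : Graph (Fin N) E where
  vertexSet := Set.univ
  IsLink i m n := ∃ x y : p.Pos, x ≠ y ∧ p.letter x = i ∧ p.letter y = i ∧ x.1 = m ∧ y.1 = n
  isLink_symm i _ := ⟨by
    rintro m n ⟨x, y, hxy, hx, hy, rfl, rfl⟩
    exact ⟨y, x, hxy.symm, hy, hx, rfl, rfl⟩⟩
  eq_or_eq_of_isLink_of_isLink := by
    rintro i m n m' n' ⟨x, y, hxy, hx, hy, rfl, rfl⟩ ⟨z, w, hzw, hz, hw, rfl, rfl⟩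
    rcases p.eq_or_eq_of_letter hzw (hz.trans hw.symm) (hx.trans hw.symm) with h | h
    · exact Or.inl (congrArg _ h)
    · exact Or.inr (congrArg _ h)
  left_mem_of_isLink _ _ _ _ := Set.mem_univ _

/-- `T` is the set of edges of a spanning tree of the word graph. -/
def IsSpanningTree (T : Set E) : Prop :=
  (p.wordGraph.restrict T).Simple ∧ (p.wordGraph.restrict T).toSimpleGraph.IsTree

/-- The sequence `x` of subsequences of the words (where `some (a, b)` is the nonempty subsequence
of `v_n` which goes forward from position `a` to position `b`, and `none` is the empty one) is
arranged cyclically as `(x'_m)`, `m ∈ ZMod M`, where `x'_m` is the subsequence of the word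
`v_(σ m)` from position `a m` to position `b m`: the last letter of each term
is the first letter of the next one. -/
structure IsCyclicArrangement (x : ∀ n, Option (ZMod (p.len n) × ZMod (p.len n))) (M : ℕ)
    (σ : ZMod M → Fin N) (a b : ∀ m, ZMod (p.len (σ m))) : Prop where
  two_le : 2 ≤ M
  injective : Function.Injective σ
  eq_some : ∀ m, x (σ m) = some (a m, b m)
  eq_none : ∀ n, n ∉ Set.range σ → x n = none
  letter_eq : ∀ m, p.entry (σ (m + 1)) (a (m + 1)) = p.entry (σ m) (b m)

/-- The cyclic sequences associated to `p`. -/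
structure CyclicSequence where
  arc : ∀ n, Option (ZMod (p.len n) × ZMod (p.len n))
  cyclic : ∃ M σ a b, p.IsCyclicArrangement arc M σ a b

end GaussParagraph

/-! ### Virtual strings -/

/-- A virtual string with underlying Gauss paragraph `p`. Its core circles correspond to the words
of `p`, the distinguished points on them to the positions in the words, and the arrow `e_i`, for
`i ∈ E`, goes from one of the two positions of the letter `i` to the other. -/
structure VirtualString {E : Type} {N : ℕ} (p : GaussParagraph E N) where
  tail : E → p.Pos
  head : E → p.Pos
  letter_tail : ∀ i, p.letter (tail i) = i
  letter_head : ∀ i, p.letter (head i) = i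
  tail_ne_head : ∀ i, tail i ≠ head i

namespace VirtualString

variable {E : Type} {N : ℕ} {p : GaussParagraph E N} (α : VirtualString p)

/-- For arrows with tails `a` and `c` on the core circle `S_n`, the number of arrowheads minus the
number of arrowtails on the arc from `a` to `c`, with `c` included and `a` excluded. -/
def q (n : Fin N) (a c : ZMod (p.len n)) : ℤ :=
  ({x | 0 < (x - a).val ∧ (x - a).val ≤ (c - a).val ∧ ∃ i, α.head i = ⟨n, x⟩}.ncard : ℤ) -
  ({x | 0 < (x - a).val ∧ (x - a).val ≤ (c - a).val ∧ ∃ i, α.tail i = ⟨n, x⟩}.ncard : ℤ)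

/-- `P` is the word-wise partition induced by `α`: the set `A n ∪ A' n` consists of the arrows
with tail on `S_n`, and it is divided into `A n` and `A' n` according to the parity of `q`. -/
structure Induces (P : p.WordwisePartition) : Prop where
  tail_mem : ∀ n i, i ∈ P.A n ∪ P.A' n ↔ (α.tail i).1 = n
  same_iff : ∀ n i j a c, α.tail i = ⟨n, a⟩ → α.tail j = ⟨n, c⟩ →
    ((i ∈ P.A n ∧ j ∈ P.A n) ∨ (i ∈ P.A' n ∧ j ∈ P.A' n) ↔ Even (α.q n a c))

/-! ### The surface of a virtual string -/

/-- The disc which thickens a vertex. -/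
abbrev Disc : Type := Metric.closedBall (0 : ℂ) 1

/-- The ribbon which thickens an edge; the first coordinate is the one along the edge. -/
abbrev Ribbon : Type := unitInterval × Set.Icc (-1 : ℝ) 1

/-- The position after `x` in its word. -/
def _root_.GaussParagraph.next (x : p.Pos) : p.Pos := ⟨x.1, x.2 + 1⟩

/-- A disc for every arrow, and a ribbon for every arc between consecutive distinguished points
of a core circle (the ribbon with index `x` runs from `x` to the next position). -/
abbrev Pieces (_α : VirtualString p) : Type := (Σ _ : E, Disc) ⊕ (Σ _ : p.Pos, Ribbon)

open Classical in
/-- The direction in which the core circle passes at `x` through the disc of the crossing: the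
branch at the tail of an arrow runs along the real axis and the branch at the head along the
imaginary axis, so that (direction at tail, direction at head) is a positive basis. -/
def dir (x : p.Pos) : ℂ := if x = α.tail (p.letter x) then 1 else Complex.I

theorem norm_dir (x : p.Pos) : ‖α.dir x‖ = 1 := by
  unfold dir; split_ifs <;> simp

/-- The boundary arc of the disc around the outgoing end of the branch at `x`. -/
def outEnd (x : p.Pos) (t : Set.Icc (-1 : ℝ) 1) : Disc :=
  ⟨α.dir x * Complex.exp (((t : ℝ) / 2 : ℝ) * Complex.I), by
    simp only [mem_closedBall_zero_iff, norm_mul, norm_dir, Complex.norm_exp_ofReal_mul_I]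
    norm_num⟩

/-- The boundary arc of the disc around the incoming end of the branch at `x`. -/
def inEnd (x : p.Pos) (t : Set.Icc (-1 : ℝ) 1) : Disc :=
  ⟨-α.dir x * Complex.exp ((-(t : ℝ) / 2 : ℝ) * Complex.I), by
    simp only [mem_closedBall_zero_iff, norm_mul, norm_neg, norm_dir,
      Complex.norm_exp_ofReal_mul_I]
    norm_num⟩

/-- The ends of the ribbons are glued to the discs, such that the orientations of the discs
and the ribbons agree. -/
inductive Glue : α.Pieces → α.Pieces → Prop
  | start (x : p.Pos) (t : Set.Icc (-1 : ℝ) 1) :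
      Glue (Sum.inr ⟨x, (0, t)⟩) (Sum.inl ⟨p.letter x, α.outEnd x t⟩)
  | finish (x : p.Pos) (t : Set.Icc (-1 : ℝ) 1) :
      Glue (Sum.inr ⟨x, (1, t)⟩) (Sum.inl ⟨p.letter (p.next x), α.inEnd (p.next x) t⟩)

/-- The surface `Σ_α`: the quotient of the disjoint union of the discs and the ribbons. -/
def Surface : Type := Quot α.Glue

instance : TopologicalSpace α.Surface := inferInstanceAs (TopologicalSpace (Quot α.Glue))

/-- The point of the surface given by a point of a disc or of a ribbon. -/
def pt (x : α.Pieces) : α.Surface := Quot.mk _ x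

theorem continuous_pt : Continuous α.pt := continuous_quot_mk

/-- The crossing with label `i`, which is the centre of a disc. -/
def crossing (i : E) : α.Surface := α.pt (Sum.inl ⟨i, ⟨0, by simp⟩⟩)

/-! ### The canonical curve -/

/-- The zero of `[-1, 1]`, which gives the middle line of a ribbon. -/
def mid : Set.Icc (-1 : ℝ) 1 := ⟨0, by simp⟩

/-- The outgoing branch at `x`, from the crossing to the beginning of the ribbon. -/
def pathOut (x : p.Pos) :
    Path (α.crossing (p.letter x)) (α.pt (Sum.inr ⟨x, (0, mid)⟩)) where
  toFun s := α.pt (Sum.inl ⟨p.letter x, ⟨((s : ℝ) : ℂ) * α.dir x, by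
    simpa [norm_dir, abs_of_nonneg s.2.1] using s.2.2⟩⟩)
  continuous_toFun := by
    refine α.continuous_pt.comp (continuous_inl.comp (continuous_sigmaMk.comp ?_))
    exact Continuous.subtype_mk (by fun_prop) _
  source' := by simp [crossing]
  target' := by
    refine Eq.trans ?_ (Quot.sound (Glue.start x mid)).symm
    simp [pt, outEnd, mid]
    rfl

/-- The middle line of the ribbon which starts at `x`. -/
def pathRibbon (x : p.Pos) :
    Path (α.pt (Sum.inr ⟨x, (0, mid)⟩)) (α.pt (Sum.inr ⟨x, (1, mid)⟩)) where
  toFun s := α.pt (Sum.inr ⟨x, (s, mid)⟩)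
  continuous_toFun :=
    α.continuous_pt.comp (continuous_inr.comp (continuous_sigmaMk.comp (by fun_prop)))
  source' := rfl
  target' := rfl

/-- The incoming branch at the position after `x`, from the end of the ribbon to the crossing. -/
def pathIn (x : p.Pos) :
    Path (α.pt (Sum.inr ⟨x, (1, mid)⟩)) (α.crossing (p.letter (p.next x))) where
  toFun s := α.pt (Sum.inl ⟨p.letter (p.next x), ⟨-(((1 - s : ℝ) : ℂ) * α.dir (p.next x)), by
    have h : ‖((1 - s : ℝ) : ℂ)‖ = 1 - s := by
      rw [Complex.norm_real, Real.norm_of_nonneg (by linarith [s.2.2])]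
    rw [mem_closedBall_zero_iff, norm_neg, norm_mul, norm_dir, h]
    linarith [s.2.1]⟩⟩)
  continuous_toFun := by
    refine α.continuous_pt.comp (continuous_inl.comp (continuous_sigmaMk.comp ?_))
    exact Continuous.subtype_mk (by fun_prop) _
  source' := by
    refine Eq.trans ?_ (Quot.sound (Glue.finish x mid)).symm
    simp [pt, inEnd, mid]
    rfl
  target' := by simp [crossing]

/-- The canonical curve on the arc between consecutive distinguished points `x` and
`p.next x`. -/
def edgePath (x : p.Pos) : Path (α.crossing (p.letter x)) (α.crossing (p.letter (p.next x))) :=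
  ((α.pathOut x).trans (α.pathRibbon x)).trans (α.pathIn x)

/-- The canonical curve on the part of the core circle `S_n` which starts at the distinguished
point `a` and consists of the next `k` arcs between consecutive distinguished points. -/
def curve (n : Fin N) (a : ZMod (p.len n)) : (k : ℕ) →
    Path (α.crossing (p.entry n a)) (α.crossing (p.entry n (a + k)))
  | 0 => (Path.refl _).cast rfl (by simp)
  | k + 1 => (curve n a k).trans
      ((α.edgePath ⟨n, a + k⟩).cast rfl
        (by simp [GaussParagraph.next, GaussParagraph.entry, add_assoc]))

/-- The canonical curve on the arc of `S_n` from the distinguished point `a` to the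
distinguished point `b`. -/
def arcPath (n : Fin N) (a b : ZMod (p.len n)) :
    Path (α.crossing (p.entry n a)) (α.crossing (p.entry n b)) :=
  (α.curve n a (b - a).val).cast rfl (by simp)

/-! ### Homology classes -/

/-- The class `[S_n]` of the component of the canonical curve given by the core circle `S_n`. -/
def circleClass (n : Fin N) : H1 α.Surface :=
  cycleClass (pathChain (α.curve n 0 (p.len n))) (by rw [pathChain_d]; simp)

/-- The class of the loop given by an arc of `S_n` whose end points have the same image. -/
def loopClass (n : Fin N) (a b : ZMod (p.len n)) (h : p.entry n a = p.entry n b) : H1 α.Surface :=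
  cycleClass (pathChain (α.arcPath n a b)) (by rw [pathChain_d, h, sub_self])

/-- The two end points of the arrow of a double letter lie on the same core circle. -/
theorem head_fst_eq_tail_fst {i : E} (hi : ∃ n, p.IsDouble n i) :
    (α.head i).1 = (α.tail i).1 := by
  obtain ⟨n, hn⟩ := hi
  obtain ⟨a, b, hab, h⟩ := Set.ncard_eq_two.1 hn
  have ha : p.letter ⟨n, a⟩ = i := by
    have : a ∈ {k | p.entry n k = i} := by rw [h]; simp
    exact this
  have hb : p.letter ⟨n, b⟩ = i := by
    have : b ∈ {k | p.entry n k = i} := by rw [h]; simp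
    exact this
  have hne : (⟨n, a⟩ : p.Pos) ≠ ⟨n, b⟩ := by simpa using hab
  have h1 := p.eq_or_eq_of_letter (z := α.head i) hne (ha.trans hb.symm)
    ((α.letter_head i).trans hb.symm)
  have h2 := p.eq_or_eq_of_letter (z := α.tail i) hne (ha.trans hb.symm)
    ((α.letter_tail i).trans hb.symm)
  rcases h1 with h1 | h1 <;> rcases h2 with h2 | h2 <;> rw [h1, h2]

/-- The class `[e_i]` of a double letter `i`: the class of the image of the arc from the tail
to the head of the arrow `e_i`. -/
def arrowClass (i : E) (hi : ∃ n, p.IsDouble n i) : H1 α.Surface :=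
  α.loopClass (α.tail i).1 (α.tail i).2 (α.head_fst_eq_tail_fst hi ▸ (α.head i).2) (by
    have h : ∀ (x : p.Pos) (n : Fin N) (e : x.1 = n), p.entry n (e ▸ x.2) = p.letter x := by
      rintro x n rfl; rfl
    rw [h]
    exact (α.letter_tail i).trans (α.letter_head i).symm)

/-- The singular 1-chain given by the arc of `S_n` from `a` to `b`; it is zero if there is no
arc. -/
def arcChain (n : Fin N) : Option (ZMod (p.len n) × ZMod (p.len n)) →
    (ModuleCat.of ℤ ℤ ⟶ (singularChains α.Surface).X 1)
  | none => 0
  | some (a, b) => pathChain (α.arcPath n a b)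

/-- The sum of the arcs of a cyclic sequence is a cycle. -/
theorem sum_arcChain_d (d : p.CyclicSequence) :
    (∑ n, α.arcChain n (d.arc n)) ≫ (singularChains α.Surface).d 1 0 = 0 := by
  obtain ⟨x, M, σ, a, b, h⟩ := d
  have : NeZero M := ⟨by have := h.two_le; omega⟩
  have h1 : ∑ n, α.arcChain n (x n) = ∑ m, α.arcChain (σ m) (x (σ m)) := by
    refine (Finset.sum_of_injOn σ h.injective.injOn (by simp) ?_ (fun _ _ => rfl)).symm
    intro n _ hn
    rw [h.eq_none n (by simpa using hn)]
    rfl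
  rw [h1, Preadditive.sum_comp]
  have h2 : ∀ m, α.arcChain (σ m) (x (σ m)) ≫ (singularChains α.Surface).d 1 0 =
      pointChain (α.crossing (p.entry (σ (m + 1)) (a (m + 1)))) -
        pointChain (α.crossing (p.entry (σ m) (a m))) := by
    intro m
    rw [h.eq_some m, h.letter_eq m]
    exact pathChain_d _
  rw [Finset.sum_congr rfl (fun m _ => h2 m), Finset.sum_sub_distrib, sub_eq_zero]
  exact Equiv.sum_comp (Equiv.addRight (1 : ZMod M))
    (fun m => pointChain (α.crossing (p.entry (σ m) (a m))))

/-- The class `[C_d]` of the loop which is the union of the images of the arcs of a cyclic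
sequence `d`. -/
def cyclicClass (d : p.CyclicSequence) : H1 α.Surface :=
  cycleClass (∑ n, α.arcChain n (d.arc n)) (α.sum_arcChain_d d)

/-- `d` is the cyclic sequence associated to the single letter `i ∉ T`, where `T` is a spanning
tree: it traverses the arrow `e_i` from its tail to its head and then returns to the tail of `e_i`
by passing from core circle to core circle through crossings with labels in `T` only. So the
crossings between its arcs are the edges of the unique cycle in `T ∪ {i}`. -/
def IsAssociated (T : Set E) (i : E) (d : p.CyclicSequence) : Prop :=
  ∃ M σ a b, p.IsCyclicArrangement d.arc M σ a b ∧
    α.tail i = ⟨σ (-1), b (-1)⟩ ∧ α.head i = ⟨σ 0, a 0⟩ ∧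
    ∀ m, m ≠ 0 → p.entry (σ m) (a m) ∈ T

end VirtualString

end

/-! The surface retracts onto the 4-valent graph of the curve, so its first homology is the group of
integral cycles of that graph, and these are analysed by their flow from core circle to core circle.

Topology. All computations take place in `ChainQuot`, the singular 1-chains modulo boundaries, which
contains `H1`. Modulo the span of the edges of the curve, the class of every path is the difference
of a potential at its ends (`mkQ_pathClass_eq_potential`, from the deformation), hence every
homology class is an integral combination of edges. Maps which wrap one ribbon around a circle give
winding numbers, which show that the edges are independent (`edgeChain_injective`). The coefficient
of the boundary at each crossing gives the cycle condition (`mem_edgeCycles`).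

Combinatorics. The jump of an edge chain at a distinguished point is its value after the point minus
its value before it. For a cycle the jumps at tail and head of an arrow are opposite, so the jump at
the head is a flow along the arrow. A cycle without flow is constant on every core circle, hence a
combination of the circles. The flow of any cycle is conserved at every word, so it is a cycle of
the word graph, and by the cuts defined by the edges of a spanning tree T it vanishes if it vanishes
outside T. Thus a cycle is determined, up to circles, by its flow on the letters outside T. There
the circles have flow 0, the loop of a double letter i has flow -1 on i and 0 elsewhere, and a
cyclic sequence associated to i has flow 1 on i and 0 elsewhere. This gives independence and
generation (`linearIndependent_cycles`, `edgeCycles_le_span`). -/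

noncomputable section
open CategoryTheory

/-! ### Singular 1-chains modulo boundaries -/

section ChainClasses

variable {X : Type} [TopologicalSpace X]

/-- Singular 1-chains modulo boundaries. -/
abbrev ChainQuot (X : Type) [TopologicalSpace X] : ModuleCat.{0} ℤ := (singularChains X).opcycles 1

/-- The class modulo boundaries of a singular 1-chain. -/
def chainClass (c : ModuleCat.of ℤ ℤ ⟶ (singularChains X).X 1) : ChainQuot X :=
  (c ≫ (singularChains X).pOpcycles 1).hom (1 : ℤ)

theorem chainClass_zero : chainClass (0 : ModuleCat.of ℤ ℤ ⟶ (singularChains X).X 1) = 0 := by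
  simp [chainClass]

theorem chainClass_add (c d : ModuleCat.of ℤ ℤ ⟶ (singularChains X).X 1) :
    chainClass (c + d) = chainClass c + chainClass d := by
  simp [chainClass]

theorem chainClass_sum {ι : Type*} (s : Finset ι)
    (c : ι → (ModuleCat.of ℤ ℤ ⟶ (singularChains X).X 1)) :
    chainClass (∑ i ∈ s, c i) = ∑ i ∈ s, chainClass (c i) := by
  classical
  induction s using Finset.induction_on with
  | empty => simp [chainClass_zero]
  | insert i s hi ih => rw [Finset.sum_insert hi, Finset.sum_insert hi, chainClass_add, ih]

/-- The inclusion of the first homology group. -/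
def homologyInclusion (X : Type) [TopologicalSpace X] : H1 X →ₗ[ℤ] ChainQuot X :=
  ((singularChains X).homologyι 1).hom

theorem homologyInclusion_injective : Function.Injective (homologyInclusion X) :=
  (ModuleCat.mono_iff_injective _).1 inferInstance

/-- The bridge from the homology classes to chains: in `ChainQuot` a cycle can be cut into paths
which are not closed. -/
theorem homologyInclusion_cycleClass (c : ModuleCat.of ℤ ℤ ⟶ (singularChains X).X 1)
    (hc : c ≫ (singularChains X).d 1 0 = 0) :
    homologyInclusion X (cycleClass c hc) = chainClass c := by
  change (((singularChains X).liftCycles c 0 (by simp) hc ≫ (singularChains X).homologyπ 1) ≫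
    (singularChains X).homologyι 1).hom (1 : ℤ) = _
  rw [Category.assoc, HomologicalComplex.homology_π_ι, HomologicalComplex.liftCycles_i_assoc]
  rfl

/-- The class modulo boundaries of a path. -/
def pathClass {x y : X} (γ : Path x y) : ChainQuot X := chainClass (pathChain γ)

/-- The boundary map. -/
def chainBoundary (X : Type) [TopologicalSpace X] :
    ChainQuot X →ₗ[ℤ] (singularChains X).X 0 :=
  ((singularChains X).fromOpcycles 1 0).hom

theorem chainBoundary_pathClass {x y : X} (γ : Path x y) :
    chainBoundary X (pathClass γ) =
      (pointChain y).hom (1 : ℤ) - (pointChain x).hom (1 : ℤ) := by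
  change ((pathChain γ ≫ (singularChains X).pOpcycles 1) ≫
    (singularChains X).fromOpcycles 1 0).hom (1 : ℤ) = _
  rw [Category.assoc, HomologicalComplex.p_fromOpcycles, pathChain_d]
  rfl

theorem chainBoundary_homologyInclusion (c : H1 X) :
    chainBoundary X (homologyInclusion X c) = 0 := by
  change ((singularChains X).homologyι 1 ≫ (singularChains X).fromOpcycles 1 0).hom c = 0
  rw [HomologicalComplex.homologyι_comp_fromOpcycles]
  rfl

/-- The singular `n`-simplices of `X`. -/
abbrev SingularSimplex (X : Type) [TopologicalSpace X] (n : ℕ) : Type :=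
  (TopCat.toSSet.obj (TopCat.of X)).obj (.op (.mk n))

/-- The singular chain given by a singular simplex. -/
def simplexChain {n : ℕ} (σ : SingularSimplex X n) :
    ModuleCat.of ℤ ℤ ⟶ (singularChains X).X n :=
  (TopCat.toSSet.obj (TopCat.of X)).ιChainComplex σ

theorem simplexChain_d {n : ℕ} (σ : SingularSimplex X (n + 1)) :
    simplexChain σ ≫ (singularChains X).d (n + 1) n = ∑ i : Fin (n + 2),
      (-1) ^ i.val • simplexChain ((TopCat.toSSet.obj (TopCat.of X)).δ i σ) :=
  (TopCat.toSSet.obj (TopCat.of X)).ιChainComplex_d (R := ModuleCat.of ℤ ℤ) σ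

theorem singularChains_hom_ext {n : ℕ} {M : ModuleCat.{0} ℤ} {f g : (singularChains X).X n ⟶ M}
    (h : ∀ σ : SingularSimplex X n, simplexChain σ ≫ f = simplexChain σ ≫ g) : f = g :=
  SSet.chainComplex_hom_ext h

/-- The map on singular chains with given values on the singular simplices. -/
def singularChainsDesc {n : ℕ} {M : ModuleCat.{0} ℤ} (f : SingularSimplex X n → M) :
    (singularChains X).X n ⟶ M :=
  Limits.Cofan.IsColimit.desc
    ((TopCat.toSSet.obj (TopCat.of X)).isColimitChainComplexXCofan (ModuleCat.of ℤ ℤ) n)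
    (fun σ => ModuleCat.ofHom (LinearMap.toSpanSingleton ℤ M (f σ)))

theorem simplexChain_desc {n : ℕ} {M : ModuleCat.{0} ℤ} (f : SingularSimplex X n → M)
    (σ : SingularSimplex X n) : simplexChain σ ≫ singularChainsDesc f =
      ModuleCat.ofHom (LinearMap.toSpanSingleton ℤ M (f σ)) :=
  Limits.Cofan.IsColimit.fac
    ((TopCat.toSSet.obj (TopCat.of X)).isColimitChainComplexXCofan (ModuleCat.of ℤ ℤ) n) _ σ

/-- The singular 1-simplex given by a path. -/
def pathSimplex {x y : X} (γ : Path x y) : SingularSimplex X 1 :=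
  (TopCat.toSSetObj₁Equiv (X := TopCat.of X)).symm
      ((TopCat.pathEquiv (X := TopCat.of X)).symm γ).hom

theorem toSSetObjEquiv_pathSimplex {x y : X} (γ : Path x y) (w : stdSimplex ℝ (Fin 2)) :
    (TopCat.of X).toSSetObjEquiv _ (pathSimplex γ) w = γ (stdSimplexHomeomorphUnitInterval w) :=
  rfl

/-- Allows linear maps on 1-chains to be compared on paths only. -/
theorem exists_pathSimplex_eq (σ : SingularSimplex X 1) :
    ∃ (x y : X) (γ : Path x y), pathSimplex γ = σ := by
  let g : unitInterval → X := fun s =>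
    (TopCat.of X).toSSetObjEquiv _ σ (stdSimplexHomeomorphUnitInterval.symm s)
  have hg : Continuous g := by fun_prop
  refine ⟨g 0, g 1, ⟨⟨g, hg⟩, rfl, rfl⟩, ?_⟩
  apply ((TopCat.of X).toSSetObjEquiv _).injective
  ext w
  rw [toSSetObjEquiv_pathSimplex]
  change g _ = _
  simp [g]

/-- The sides of a singular 2-simplex. -/
theorem pathClass_eq_add_of_simplex {x y z : X} (γ : Path x y) (δ : Path y z) (ε : Path x z)
    (τ : C(stdSimplex ℝ (Fin 3), X))
    (hγ : ∀ w, τ (stdSimplex.map (Fin.succAbove 2) w) = γ (stdSimplexHomeomorphUnitInterval w))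
    (hδ : ∀ w, τ (stdSimplex.map (Fin.succAbove 0) w) = δ (stdSimplexHomeomorphUnitInterval w))
    (hε : ∀ w, τ (stdSimplex.map (Fin.succAbove 1) w) = ε (stdSimplexHomeomorphUnitInterval w)) :
    pathClass ε = pathClass γ + pathClass δ := by
  let t : SingularSimplex X 2 :=
    ((TopCat.of X).toSSetObjEquiv _).symm τ
  have h0 : (TopCat.toSSet.obj (TopCat.of X)).δ 0 t = pathSimplex δ := by
    apply ((TopCat.of X).toSSetObjEquiv _).injective
    ext w
    exact hδ w
  have h1 : (TopCat.toSSet.obj (TopCat.of X)).δ 1 t = pathSimplex ε := by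
    apply ((TopCat.of X).toSSetObjEquiv _).injective
    ext w
    exact hε w
  have h2 : (TopCat.toSSet.obj (TopCat.of X)).δ 2 t = pathSimplex γ := by
    apply ((TopCat.of X).toSSetObjEquiv _).injective
    ext w
    exact hγ w
  have h3 : pathChain δ - pathChain ε + pathChain γ =
      simplexChain t ≫ (singularChains X).d 2 1 := by
    rw [simplexChain_d, Fin.sum_univ_three, h0, h1, h2]
    simp only [Fin.val_zero, Fin.val_one, Fin.val_two, pow_zero, pow_one, one_smul, neg_smul,
      even_two, Even.neg_pow, one_pow]
    rw [sub_eq_add_neg]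
    rfl
  have h4 : chainClass (pathChain δ - pathChain ε + pathChain γ) = 0 := by
    rw [h3, chainClass, Category.assoc, HomologicalComplex.d_pOpcycles, Limits.comp_zero]
    rfl
  have h5 : chainClass (pathChain δ - pathChain ε + pathChain γ) =
      pathClass δ - pathClass ε + pathClass γ := by
    simp [chainClass, pathClass]
  rw [h5] at h4
  have : pathClass ε = pathClass γ + pathClass δ - (pathClass δ - pathClass ε + pathClass γ) := by
    abel
  rw [this, h4, sub_zero]

/-- A linear map whose values on the classes of paths are the differences of a function on the
points of `X` vanishes on the homology of `X`. -/
theorem map_homologyInclusion_eq_zero {M : Type} [AddCommGroup M] {_ : Module ℤ M}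
    (φ : ChainQuot X →ₗ[ℤ] M) (D : X → M)
    (h : ∀ (x y : X) (γ : Path x y), φ (pathClass γ) = D y - D x) (c : H1 X) :
    φ (homologyInclusion X c) = 0 := by
  -- `F` is the linear extension of `D` to 0-chains; then `φ` is `F` after the boundary map, which
  -- kills homology.
  let F : (singularChains X).X 0 ⟶ ModuleCat.of ℤ M :=
    singularChainsDesc fun σ => D (TopCat.toSSetObj₀Equiv (X := TopCat.of X) σ)
  have hF : ∀ x, F.hom ((pointChain x).hom (1 : ℤ)) = D x := by
    intro x
    change (simplexChain ((TopCat.toSSetObj₀Equiv (X := TopCat.of X)).symm x) ≫ F).hom (1 : ℤ) = _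
    rw [simplexChain_desc]
    exact (LinearMap.toSpanSingleton_apply_one ℤ M _).trans (by rw [Equiv.apply_symm_apply])
  have hc : (singularChains X).fromOpcycles 1 0 ≫ F = ModuleCat.ofHom φ := by
    rw [← cancel_epi ((singularChains X).pOpcycles 1)]
    refine singularChains_hom_ext fun σ => ?_
    obtain ⟨x, y, γ, rfl⟩ := exists_pathSimplex_eq σ
    ext
    change F.hom (chainBoundary X (pathClass γ)) = φ (pathClass γ)
    rw [chainBoundary_pathClass, map_sub, hF, hF, h]
  change (ModuleCat.ofHom φ).hom (homologyInclusion X c) = 0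
  rw [← hc]
  change F.hom (chainBoundary X (homologyInclusion X c)) = 0
  rw [chainBoundary_homologyInclusion, map_zero]

/-- The coefficient of a point in a 0-chain. -/
theorem exists_pointCoefficient (A : Set X) : ∃ F : (singularChains X).X 0 →ₗ[ℤ] ℤ,
    ∀ x, F ((pointChain x).hom (1 : ℤ)) = A.indicator 1 x := by
  let F : (singularChains X).X 0 ⟶ ModuleCat.of ℤ ℤ :=
    singularChainsDesc fun σ => A.indicator (1 : X → ℤ) (TopCat.toSSetObj₀Equiv (X := TopCat.of X) σ)
  refine ⟨F.hom, fun x => ?_⟩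
  change (simplexChain ((TopCat.toSSetObj₀Equiv (X := TopCat.of X)).symm x) ≫ F).hom (1 : ℤ) = _
  rw [simplexChain_desc]
  simp

end ChainClasses

/-! ### Segments, concatenation, homotopy and subdivision of paths -/

section Segments

variable {X Y : Type} [TopologicalSpace X] [TopologicalSpace Y]

theorem pathClass_congr {x y x' y' : X} (γ : Path x y) (δ : Path x' y') (h : ∀ s, γ s = δ s) :
    pathClass γ = pathClass δ := by
  obtain rfl : x = x' := by rw [← γ.source, ← δ.source, h]
  obtain rfl : y = y' := by rw [← γ.target, ← δ.target, h]
  rw [show γ = δ from Path.ext (funext h)]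

theorem stdSimplex_map_succAbove_self {n : ℕ} (i : Fin (n + 2)) (w : stdSimplex ℝ (Fin (n + 1))) :
    stdSimplex.map i.succAbove w i = 0 := by
  rw [stdSimplex.map_coe, FunOnFinite.linearMap_apply_apply]
  simp [Fin.succAbove_ne]

theorem stdSimplex_map_succAbove {n : ℕ} (i : Fin (n + 2)) (w : stdSimplex ℝ (Fin (n + 1)))
    (j : Fin (n + 1)) : stdSimplex.map i.succAbove w (i.succAbove j) = w j := by
  rw [stdSimplex.map_coe, FunOnFinite.linearMap_apply_apply]
  simp [Finset.filter_eq']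

variable {V : Type} [AddCommGroup V] [Module ℝ V] [TopologicalSpace V] [IsTopologicalAddGroup V]
  [ContinuousSMul ℝ V]

/-- The image of a line segment under a continuous map. -/
def segPath (f : C(V, X)) (a b : V) : Path (f a) (f b) where
  toFun s := f ((1 - (s : ℝ)) • a + (s : ℝ) • b)
  continuous_toFun := by fun_prop
  source' := by simp
  target' := by simp

theorem segPath_apply (f : C(V, X)) (a b : V) (s : unitInterval) :
    segPath f a b s = f ((1 - (s : ℝ)) • a + (s : ℝ) • b) := rfl

/-- The image under `f` of the affine triangle with vertices `a`, `b`, `c` is a singular 2-simplex.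
Concatenations and homotopies of paths are all reduced to this relation. -/
theorem pathClass_segPath_add (f : C(V, X)) (a b c : V) :
    pathClass (segPath f a b) + pathClass (segPath f b c) = pathClass (segPath f a c) := by
  let τ : C(stdSimplex ℝ (Fin 3), X) :=
    ⟨fun w => f (w 0 • a + w 1 • b + w 2 • c), by
      have h : ∀ i : Fin 3, Continuous fun w : stdSimplex ℝ (Fin 3) => w i :=
        fun i => (continuous_apply i).comp continuous_subtype_val
      exact f.continuous.comp ((((h 0).smul continuous_const).add
        ((h 1).smul continuous_const)).add ((h 2).smul continuous_const))⟩
  have key : ∀ w : stdSimplex ℝ (Fin 2), w 0 = 1 - (stdSimplexHomeomorphUnitInterval w : ℝ) ∧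
      w 1 = (stdSimplexHomeomorphUnitInterval w : ℝ) := by
    intro w
    have h1 : (stdSimplexHomeomorphUnitInterval w : ℝ) = w 1 := rfl
    have := stdSimplex.add_eq_one w
    exact ⟨by rw [h1]; linarith, h1.symm⟩
  refine (pathClass_eq_add_of_simplex _ _ _ τ (fun w => ?_) (fun w => ?_) (fun w => ?_)).symm
  · have h0 := stdSimplex_map_succAbove 2 w 0
    have h1 := stdSimplex_map_succAbove 2 w 1
    have h2 := stdSimplex_map_succAbove_self 2 w
    rw [show Fin.succAbove (2 : Fin 3) 0 = 0 from rfl] at h0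
    rw [show Fin.succAbove (2 : Fin 3) 1 = 1 from rfl] at h1
    change f _ = f _
    rw [h0, h1, h2, (key w).1, (key w).2, zero_smul, add_zero]
  · have h0 := stdSimplex_map_succAbove 0 w 0
    have h1 := stdSimplex_map_succAbove 0 w 1
    have h2 := stdSimplex_map_succAbove_self 0 w
    rw [show Fin.succAbove (0 : Fin 3) 0 = 1 from rfl] at h0
    rw [show Fin.succAbove (0 : Fin 3) 1 = 2 from rfl] at h1
    change f _ = f _
    rw [h0, h1, h2, (key w).1, (key w).2, zero_smul, zero_add]
  · have h0 := stdSimplex_map_succAbove 1 w 0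
    have h1 := stdSimplex_map_succAbove 1 w 1
    have h2 := stdSimplex_map_succAbove_self 1 w
    rw [show Fin.succAbove (1 : Fin 3) 0 = 0 from rfl] at h0
    rw [show Fin.succAbove (1 : Fin 3) 1 = 2 from rfl] at h1
    change f _ = f _
    rw [h0, h1, h2, (key w).1, (key w).2, zero_smul, add_zero]

theorem pathClass_segPath_self (f : C(V, X)) (a : V) : pathClass (segPath f a a) = 0 := by
  have := pathClass_segPath_add f a a a
  simpa using this

theorem pathClass_refl (x : X) : pathClass (Path.refl x) = 0 := by
  rw [← pathClass_segPath_self (ContinuousMap.const ℝ x) 0]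
  exact pathClass_congr _ _ fun s => rfl

theorem pathClass_const {x y : X} (γ : Path x y) (h : ∀ s, γ s = x) : pathClass γ = 0 := by
  rw [← pathClass_refl x]
  exact pathClass_congr _ _ h

theorem pathClass_eq_segPath_extend {x y : X} (γ : Path x y) :
    pathClass γ = pathClass (segPath ⟨γ.extend, γ.continuous_extend⟩ (0 : ℝ) 1) :=
  pathClass_congr _ _ fun s => by simp [segPath_apply]

theorem pathClass_trans {x y z : X} (γ : Path x y) (δ : Path y z) :
    pathClass (γ.trans δ) = pathClass γ + pathClass δ := by
  rw [pathClass_eq_segPath_extend, ← pathClass_segPath_add _ 0 (1 / 2) 1]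
  congr 1
  · refine pathClass_congr _ _ fun s => ?_
    have h := s.2
    have h1 : (s : ℝ) * 2⁻¹ ∈ unitInterval := ⟨by linarith [h.1], by linarith [h.2]⟩
    have h2 : (s : ℝ) * 2⁻¹ ≤ 1 / 2 := by linarith [h.2]
    simp only [segPath_apply, ContinuousMap.coe_mk, mul_zero, zero_add, smul_eq_mul, one_div]
    rw [Path.extend_apply _ h1, Path.trans_apply, dif_pos h2]
    congr 1
    ext
    simp
    ring
  · refine pathClass_congr _ _ fun s => ?_
    have h := s.2
    have h1 : (1 - (s : ℝ)) * (1 / 2) + s * 1 ∈ unitInterval :=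
      ⟨by linarith [h.1, h.2], by linarith [h.1, h.2]⟩
    simp only [segPath_apply, ContinuousMap.coe_mk, smul_eq_mul]
    rw [Path.extend_apply _ h1, Path.trans_apply]
    split_ifs with h2
    · have h3 : (s : ℝ) = 0 := by
        have h2 : (1 - (s : ℝ)) * (1 / 2) + s * 1 ≤ 1 / 2 := h2
        linarith [h.1]
      have : s = 0 := Subtype.ext h3
      subst this
      simp
    · congr 1
      ext
      simp
      ring

theorem pathClass_cast {x y x' y' : X} (γ : Path x y) (hx : x' = x) (hy : y' = y) :
    pathClass (γ.cast hx hy) = pathClass γ :=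
  pathClass_congr _ _ fun _ => rfl

/-- The track of a point under a homotopy. -/
def trackPath (K : C(X × unitInterval, Y)) (x : X) : Path (K (x, 0)) (K (x, 1)) where
  toFun u := K (x, u)
  continuous_toFun := by fun_prop
  source' := rfl
  target' := rfl

/-- The image of a path at a fixed time of a homotopy. -/
def slicePath (K : C(X × unitInterval, Y)) (u : unitInterval) {x y : X} (γ : Path x y) :
    Path (K (x, u)) (K (y, u)) where
  toFun s := K (γ s, u)
  continuous_toFun := by fun_prop
  source' := by simp
  target' := by simp

/-- Both ways around the square are equivalent to its diagonal. -/
theorem pathClass_homotopy (K : C(X × unitInterval, Y)) {x y : X} (γ : Path x y) :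
    pathClass (slicePath K 0 γ) + pathClass (trackPath K y) =
      pathClass (trackPath K x) + pathClass (slicePath K 1 γ) := by
  -- The square is extended to the whole plane, since segments are taken in a vector space.
  let f : C(ℝ × ℝ, Y) := ⟨fun q => K (γ.extend q.1, Set.projIcc 0 1 zero_le_one q.2), by
    have := γ.continuous_extend
    have : Continuous (Set.projIcc (0 : ℝ) 1 zero_le_one) := continuous_projIcc
    fun_prop⟩
  have h := (pathClass_segPath_add f (0, 0) (1, 0) (1, 1)).trans
    (pathClass_segPath_add f (0, 0) (0, 1) (1, 1)).symm
  have e1 : pathClass (slicePath K 0 γ) = pathClass (segPath f (0, 0) (1, 0)) :=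
    pathClass_congr _ _ fun s => by simp [segPath_apply, f, slicePath]
  have e2 : pathClass (trackPath K y) = pathClass (segPath f (1, 0) (1, 1)) :=
    pathClass_congr _ _ fun s => by simp [segPath_apply, f, trackPath]
  have e3 : pathClass (trackPath K x) = pathClass (segPath f (0, 0) (0, 1)) :=
    pathClass_congr _ _ fun s => by simp [segPath_apply, f, trackPath]
  have e4 : pathClass (slicePath K 1 γ) = pathClass (segPath f (0, 1) (1, 1)) :=
    pathClass_congr _ _ fun s => by simp [segPath_apply, f, slicePath]
  rw [e1, e2, e3, e4, h]

/-- To compute the values of a linear map on the classes of paths, small paths suffice. -/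
theorem map_pathClass_eq_of_cover {M : Type} [AddCommGroup M] {_ : Module ℤ M}
    (φ : ChainQuot X →ₗ[ℤ] M) (D : X → M) {ι : Type} (U : ι → Set X) (hU : ∀ i, IsOpen (U i))
    (hcov : ∀ x, ∃ i, x ∈ U i)
    (h : ∀ i (x y : X) (γ : Path x y), (∀ s, γ s ∈ U i) → φ (pathClass γ) = D y - D x)
    {x y : X} (γ : Path x y) : φ (pathClass γ) = D y - D x := by
  -- A Lebesgue subdivision: each piece of the path lies in one set of the cover, and the
  -- differences of `D` telescope.
  obtain ⟨t, ht0, hmono, ⟨m, hm⟩, ht⟩ :=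
    exists_monotone_Icc_subset_open_cover_unitInterval (c := fun i => γ ⁻¹' U i)
      (fun i => (hU i).preimage γ.continuous)
      (fun s _ => Set.mem_iUnion.2 (hcov (γ s)))
  let f : C(ℝ, X) := ⟨γ.extend, γ.continuous_extend⟩
  have key : ∀ k, φ (pathClass (segPath f (t 0 : ℝ) (t k))) = D (f (t k)) - D (f (t 0)) := by
    intro k
    induction k with
    | zero => rw [pathClass_segPath_self, map_zero, sub_self]
    | succ k ih =>
      rw [← pathClass_segPath_add f (t 0 : ℝ) (t k) (t (k + 1)), map_add, ih]
      obtain ⟨i, hi⟩ := ht k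
      rw [h i _ _ (segPath f (t k : ℝ) (t (k + 1)))]
      · abel
      · intro s
        have hle : (t k : ℝ) ≤ t (k + 1) := hmono (Nat.le_succ k)
        have hs := s.2
        have h1 : (t k : ℝ) ≤ (1 - (s : ℝ)) * t k + s * t (k + 1) := by nlinarith [hs.1, hs.2]
        have h2 : (1 - (s : ℝ)) * t k + s * t (k + 1) ≤ t (k + 1) := by nlinarith [hs.1, hs.2]
        have h3 : (1 - (s : ℝ)) * t k + s * t (k + 1) ∈ unitInterval :=
          ⟨(t k).2.1.trans h1, h2.trans (t (k + 1)).2.2⟩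
        have h4 := hi (show (⟨_, h3⟩ : unitInterval) ∈ Set.Icc (t k) (t (k + 1)) from ⟨h1, h2⟩)
        change γ.extend _ ∈ _
        simp only [smul_eq_mul]
        rw [Path.extend_apply _ h3]
        exact h4
  have := key m
  rw [hm m le_rfl, ht0] at this
  have e : pathClass γ = pathClass (segPath f ((0 : unitInterval) : ℝ) ((1 : unitInterval) : ℝ)) :=
    pathClass_eq_segPath_extend γ
  rw [e, this]
  simp [f]

end Segments

/-! ### Winding numbers of maps to the circle -/

section Winding

variable {X : Type} [TopologicalSpace X]

/-- After a shift by the integer `G b - H b` the two lifts agree at `b`, hence everywhere by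
uniqueness of lifts. So an increment does not depend on the lift. -/
theorem lift_sub_lift_eq {A : Type} [TopologicalSpace A] [PreconnectedSpace A] (G H : C(A, ℝ))
    (h : ∀ a, (G a : AddCircle (1 : ℝ)) = H a) (a b : A) : G a - G b = H a - H b := by
  have h1 : (fun x => H x + (G b - H b)) = fun x => G x := by
    refine (AddCircle.isCoveringMap_coe (1 : ℝ)).eq_of_comp_eq (by fun_prop) (by fun_prop) ?_ b
      (by ring)
    funext x
    simp [h]
  have := congrFun h1 a
  linarith

theorem exists_lift_stdSimplex (n : ℕ) (g : C(stdSimplex ℝ (Fin (n + 1)), AddCircle (1 : ℝ))) :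
    ∃ G : C(stdSimplex ℝ (Fin (n + 1)), ℝ), ∀ w, (G w : AddCircle (1 : ℝ)) = g w := by
  have hc := convex_stdSimplex ℝ (Fin (n + 1))
  have := hc.locallyPathConnectedSpace
  have := hc.contractibleSpace ⟨_, (stdSimplex.vertex (S := ℝ) (0 : Fin (n + 1))).2⟩
  obtain ⟨e, he⟩ := QuotientAddGroup.mk_surjective (g (stdSimplex.vertex 0))
  obtain ⟨G, ⟨-, hG⟩, -⟩ := (AddCircle.isCoveringMap_coe (1 : ℝ)).existsUnique_continuousMap_lifts g
    (stdSimplex.vertex 0) e he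
  exact ⟨G, fun w => congrFun hG w⟩

/-- A map to the circle determines a linear functional on the chains modulo boundaries. -/
theorem exists_winding (f : C(X, AddCircle (1 : ℝ))) : ∃ W : ChainQuot X →ₗ[ℤ] ℝ,
    ∀ (x y : X) (γ : Path x y) (G : C(unitInterval, ℝ)),
      (∀ s, (G s : AddCircle (1 : ℝ)) = f (γ s)) → W (pathClass γ) = G 1 - G 0 := by
  let toMap (n : ℕ) (σ : SingularSimplex X n) : C(stdSimplex ℝ (Fin (n + 1)), X) :=
    (TopCat.of X).toSSetObjEquiv _ σ
  choose G hG using fun σ : SingularSimplex X 1 => exists_lift_stdSimplex 1 (f.comp (toMap 1 σ))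
  have hconn (n : ℕ) : PreconnectedSpace (stdSimplex ℝ (Fin (n + 1))) :=
    Subtype.preconnectedSpace (convex_stdSimplex ℝ (Fin (n + 1))).isPreconnected
  let w : (singularChains X).X 1 ⟶ ModuleCat.of ℤ ℝ := singularChainsDesc fun σ =>
    G σ (stdSimplex.vertex 1) - G σ (stdSimplex.vertex 0)
  have hw : ∀ (σ : SingularSimplex X 1) (H : C(stdSimplex ℝ (Fin 2), ℝ)),
      (∀ z, (H z : AddCircle (1 : ℝ)) = f (toMap 1 σ z)) → (simplexChain σ ≫ w).hom (1 : ℤ) =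
        H (stdSimplex.vertex 1) - H (stdSimplex.vertex 0) := by
    intro σ H hH
    rw [simplexChain_desc]
    refine (LinearMap.toSpanSingleton_apply_one ℤ ℝ _).trans ?_
    have := hconn 1
    exact lift_sub_lift_eq _ _ (fun a => (hG σ a).trans (hH a).symm) _ _
  -- A lift on a 2-simplex restricts to lifts on its sides, and the three increments cancel.
  have hd : (singularChains X).d 2 1 ≫ w = 0 := by
    refine singularChains_hom_ext fun τ => ?_
    obtain ⟨H, hH⟩ := exists_lift_stdSimplex 2 (f.comp (toMap 2 τ))
    have hface (i : Fin 3) :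
        (simplexChain ((TopCat.toSSet.obj (TopCat.of X)).δ i τ) ≫ w).hom (1 : ℤ) =
          H (stdSimplex.vertex (i.succAbove 1)) - H (stdSimplex.vertex (i.succAbove 0)) := by
      rw [hw _ (H.comp ⟨stdSimplex.map i.succAbove, stdSimplex.continuous_map _⟩)
        (fun z => by exact hH (stdSimplex.map i.succAbove z))]
      simp
    ext
    rw [← Category.assoc, simplexChain_d, Fin.sum_univ_three]
    simp only [Preadditive.add_comp, Preadditive.neg_comp, Limits.comp_zero, ModuleCat.hom_add,
      LinearMap.add_apply, ModuleCat.hom_neg, LinearMap.neg_apply, hface, Fin.val_zero,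
      Fin.val_one, Fin.val_two, pow_zero, pow_one, one_smul, neg_smul, even_two, Even.neg_pow,
      one_pow]
    rw [show Fin.succAbove (2 : Fin 3) 0 = 0 from rfl, show Fin.succAbove (2 : Fin 3) 1 = 1 from rfl,
      show Fin.succAbove (1 : Fin 3) 0 = 0 from rfl, show Fin.succAbove (1 : Fin 3) 1 = 2 from rfl,
      show Fin.succAbove (0 : Fin 3) 0 = 1 from rfl, show Fin.succAbove (0 : Fin 3) 1 = 2 from rfl]
    simp
  let W : ChainQuot X ⟶ ModuleCat.of ℤ ℝ :=
    (singularChains X).descOpcycles w 2 (by simp) hd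
  refine ⟨W.hom, fun x y γ H hH => ?_⟩
  change ((simplexChain (pathSimplex γ) ≫ (singularChains X).pOpcycles 1) ≫ W).hom (1 : ℤ) = _
  rw [Category.assoc, HomologicalComplex.p_descOpcycles,
    hw _ (H.comp ⟨stdSimplexHomeomorphUnitInterval, by fun_prop⟩) (fun z => hH _)]
  simp

end Winding

section SegmentsReal

variable {X : Type} [TopologicalSpace X]

/-- A path which factors through the line is equivalent to a segment. -/
theorem pathClass_map_eq_segPath (f : C(ℝ, X)) {a b : ℝ} (g : Path a b) {x y : X} (γ : Path x y)
    (h : ∀ s, γ s = f (g s)) : pathClass γ = pathClass (segPath f a b) := by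
  -- The straight-line homotopy in ℝ from `g` to the affine path; it fixes the end points, so its
  -- tracks contribute nothing.
  let F : C(ℝ × ℝ, X) :=
    ⟨fun q => f ((1 - q.2) * g.extend q.1 + q.2 * ((1 - q.1) * a + q.1 * b)), by
      have := g.continuous_extend
      fun_prop⟩
  have h0 := (pathClass_segPath_add F (0, 0) (1, 0) (1, 1)).trans
    (pathClass_segPath_add F (0, 0) (0, 1) (1, 1)).symm
  have e1 : pathClass (segPath F (0, 0) (1, 0)) = pathClass γ :=
    pathClass_congr _ _ fun s => by simp [segPath_apply, F, h]
  have e2 : pathClass (segPath F (0, 1) (1, 1)) = pathClass (segPath f a b) :=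
    pathClass_congr _ _ fun s => by simp [segPath_apply, F]
  have e3 : pathClass (segPath F (1, 0) (1, 1)) = 0 :=
    pathClass_const _ fun s => by
      simp only [segPath_apply, F, ContinuousMap.coe_mk]
      congr 1
      simp
      ring
  have e4 : pathClass (segPath F (0, 0) (0, 1)) = 0 :=
    pathClass_const _ fun s => by
      simp only [segPath_apply, F, ContinuousMap.coe_mk]
      congr 1
      simp
      ring
  rw [e1, e2, e3, e4, add_zero, zero_add] at h0
  exact h0

end SegmentsReal

/-! ### Coordinates on the surface and the deformation -/

namespace VirtualString

variable {E : Type} {N : ℕ} {p : GaussParagraph E N} (α : VirtualString p)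

/-- Scaling of the disc. -/
def scaleDisc (r : unitInterval) (z : Disc) : Disc :=
  ⟨(r : ℝ) • (z : ℂ), by
    have hz := mem_closedBall_zero_iff.1 z.2
    rw [mem_closedBall_zero_iff, norm_smul, Real.norm_of_nonneg r.2.1]
    exact mul_le_one₀ r.2.2 (norm_nonneg _) hz⟩

theorem scaleDisc_one (z : Disc) : scaleDisc 1 z = z := Subtype.ext (by simp [scaleDisc])

theorem scaleDisc_zero (z : Disc) : scaleDisc 0 z = ⟨0, by simp⟩ :=
  Subtype.ext (by simp [scaleDisc])

theorem continuous_scaleDisc : Continuous fun q : unitInterval × Disc => scaleDisc q.1 q.2 :=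
  Continuous.subtype_mk (by fun_prop) _

/-- The retraction of the line to the unit interval. -/
def clampI (y : ℝ) : unitInterval := Set.projIcc 0 1 zero_le_one y

theorem continuous_clampI : Continuous clampI := continuous_projIcc (h := zero_le_one)

theorem clampI_of_nonpos {y : ℝ} (h : y ≤ 0) : clampI y = 0 := Set.projIcc_of_le_left _ h

theorem clampI_of_one_le {y : ℝ} (h : 1 ≤ y) : clampI y = 1 := Set.projIcc_of_right_le _ h

theorem clampI_coe (s : unitInterval) : clampI s = s := Set.projIcc_val _ s

/-- The retraction of the line to the transverse interval of a ribbon. -/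
def clampT (y : ℝ) : Set.Icc (-1 : ℝ) 1 := Set.projIcc (-1) 1 (by norm_num) y

theorem continuous_clampT : Continuous clampT := continuous_projIcc (h := by norm_num)

theorem clampT_coe (t : Set.Icc (-1 : ℝ) 1) : clampT t = t := Set.projIcc_val _ t

theorem clampT_zero : clampT 0 = mid := clampT_coe mid

theorem continuous_outEnd (x : p.Pos) : Continuous (α.outEnd x) :=
  Continuous.subtype_mk (by fun_prop) _

theorem continuous_inEnd (x : p.Pos) : Continuous (α.inEnd x) :=
  Continuous.subtype_mk (by fun_prop) _

/-- The image in the surface of a point of a disc. -/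
def discPt (i : E) (z : Disc) : α.Surface := α.pt (Sum.inl ⟨i, z⟩)

theorem continuous_discPt (i : E) : Continuous (α.discPt i) :=
  α.continuous_pt.comp (continuous_inl.comp continuous_sigmaMk)

/-- The image in the surface of a point of a ribbon. -/
def ribbonPt (x : p.Pos) (q : Ribbon) : α.Surface := α.pt (Sum.inr ⟨x, q⟩)

theorem continuous_ribbonPt (x : p.Pos) : Continuous (α.ribbonPt x) :=
  α.continuous_pt.comp (continuous_inr.comp continuous_sigmaMk)

theorem ribbonPt_zero (x : p.Pos) (t : Set.Icc (-1 : ℝ) 1) :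
    α.ribbonPt x (0, t) = α.discPt (p.letter x) (α.outEnd x t) :=
  Quot.sound (Glue.start x t)

theorem ribbonPt_one (x : p.Pos) (t : Set.Icc (-1 : ℝ) 1) :
    α.ribbonPt x (1, t) = α.discPt (p.letter (p.next x)) (α.inEnd (p.next x) t) :=
  Quot.sound (Glue.finish x t)

theorem surface_cases {C : α.Surface → Prop} (h1 : ∀ i z, C (α.discPt i z))
    (h2 : ∀ x q, C (α.ribbonPt x q)) (z : α.Surface) : C z := by
  induction z using Quot.inductionOn with
  | h a =>
    rcases a with ⟨i, z⟩ | ⟨x, q⟩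
    · exact h1 i z
    · exact h2 x q

/-- Functions on the surface. -/
def surfaceLift {C : Type*} (f : E → Disc → C) (g : p.Pos → Ribbon → C)
    (h0 : ∀ x t, g x (0, t) = f (p.letter x) (α.outEnd x t))
    (h1 : ∀ x t, g x (1, t) = f (p.letter (p.next x)) (α.inEnd (p.next x) t)) : α.Surface → C :=
  Quot.lift (Sum.elim (fun q => f q.1 q.2) (fun q => g q.1 q.2)) (by
    rintro _ _ (⟨x, t⟩ | ⟨x, t⟩)
    · exact h0 x t
    · exact h1 x t)

section surfaceLift

variable {C : Type*} (f : E → Disc → C) (g : p.Pos → Ribbon → C)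
  (h0 : ∀ x t, g x (0, t) = f (p.letter x) (α.outEnd x t))
  (h1 : ∀ x t, g x (1, t) = f (p.letter (p.next x)) (α.inEnd (p.next x) t))

theorem continuous_surfaceLift [TopologicalSpace C] (hf : ∀ i, Continuous (f i))
    (hg : ∀ x, Continuous (g x)) : Continuous (α.surfaceLift f g h0 h1) := by
  refine continuous_quot_lift _ ?_
  refine continuous_sum_dom.2 ⟨?_, ?_⟩
  · exact continuous_sigma hf
  · exact continuous_sigma hg

end surfaceLift

theorem isOpen_surface {A : Set α.Surface} (h1 : ∀ i, IsOpen (α.discPt i ⁻¹' A))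
    (h2 : ∀ x, IsOpen (α.ribbonPt x ⁻¹' A)) : IsOpen A := by
  refine isQuotientMap_quot_mk.isOpen_preimage.1 ?_
  exact isOpen_sum_iff.2 ⟨isOpen_sigma_iff.2 h1, isOpen_sigma_iff.2 h2⟩

/-! ### The deformation to the curve -/

/-- The ribbon `x` together with the adjacent sectors of discs. -/
def strip (x : p.Pos) (q : ℝ × ℝ) : α.Surface :=
  if q.1 ≤ 0 then α.discPt (p.letter x) (scaleDisc (clampI (1 + q.1)) (α.outEnd x (clampT q.2)))
  else if q.1 ≤ 1 then α.ribbonPt x (clampI q.1, clampT q.2)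
  else α.discPt (p.letter (p.next x))
    (scaleDisc (clampI (2 - q.1)) (α.inEnd (p.next x) (clampT q.2)))

theorem strip_of_le_zero (x : p.Pos) {y : ℝ} (t : ℝ) (h : y ≤ 0) : α.strip x (y, t) =
    α.discPt (p.letter x) (scaleDisc (clampI (1 + y)) (α.outEnd x (clampT t))) := if_pos h

theorem strip_of_mem (x : p.Pos) {y : ℝ} (t : ℝ) (h0 : 0 ≤ y) (h1 : y ≤ 1) : α.strip x (y, t) =
    α.ribbonPt x (clampI y, clampT t) := by
  rcases h0.eq_or_lt with rfl | h0
  · rw [strip_of_le_zero _ _ _ le_rfl, clampI_of_one_le (by norm_num), scaleDisc_one,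
      clampI_of_nonpos le_rfl, ribbonPt_zero]
  · simp only [strip]
    rw [if_neg (not_le.2 h0), if_pos h1]

theorem strip_of_one_le (x : p.Pos) {y : ℝ} (t : ℝ) (h : 1 ≤ y) : α.strip x (y, t) =
    α.discPt (p.letter (p.next x)) (scaleDisc (clampI (2 - y)) (α.inEnd (p.next x) (clampT t))) := by
  rcases h.eq_or_lt with rfl | h
  · rw [strip_of_mem _ _ _ zero_le_one le_rfl, clampI_of_one_le le_rfl,
      clampI_of_one_le (by norm_num), scaleDisc_one, ribbonPt_one]
  · simp only [strip]
    rw [if_neg (by linarith), if_neg (not_le.2 h)]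

theorem continuous_strip (x : p.Pos) : Continuous (α.strip x) := by
  have hI := continuous_clampI
  have hT := continuous_clampT
  have ho := α.continuous_outEnd x
  have hi := α.continuous_inEnd (p.next x)
  have hs := continuous_scaleDisc
  refine Continuous.if_le ?_ (Continuous.if_le ?_ ?_ continuous_fst continuous_const ?_)
    continuous_fst continuous_const ?_
  · exact (α.continuous_discPt _).comp (hs.comp (Continuous.prodMk (by fun_prop) (by fun_prop)))
  · exact (α.continuous_ribbonPt _).comp (Continuous.prodMk (by fun_prop) (by fun_prop))
  · exact (α.continuous_discPt _).comp (hs.comp (Continuous.prodMk (by fun_prop) (by fun_prop)))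
  · rintro ⟨y, t⟩ (rfl : y = 1)
    exact (α.strip_of_mem x t zero_le_one le_rfl).symm.trans (α.strip_of_one_le x t le_rfl)
  · rintro ⟨y, t⟩ (rfl : y = 0)
    rw [if_pos zero_le_one]
    exact (α.strip_of_le_zero x t le_rfl).symm.trans (α.strip_of_mem x t le_rfl zero_le_one)

theorem discPt_scaleDisc_zero (i : E) (z : Disc) : α.discPt i (scaleDisc 0 z) = α.crossing i := by
  rw [scaleDisc_zero]
  rfl

theorem strip_of_le_neg_one (x : p.Pos) {y : ℝ} (t : ℝ) (h : y ≤ -1) :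
    α.strip x (y, t) = α.crossing (p.letter x) := by
  rw [strip_of_le_zero _ _ _ (by linarith), clampI_of_nonpos (by linarith), discPt_scaleDisc_zero]

theorem strip_of_two_le (x : p.Pos) {y : ℝ} (t : ℝ) (h : 2 ≤ y) :
    α.strip x (y, t) = α.crossing (p.letter (p.next x)) := by
  rw [strip_of_one_le _ _ _ (by linarith), clampI_of_nonpos (by linarith), discPt_scaleDisc_zero]

/-- The deformation of the surface to the curve shrinks the discs to their centres and stretches the
ribbons, and then shrinks the ribbons to their middle lines. -/
def deformation : C(α.Surface × unitInterval, α.Surface) :=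
  ContinuousMap.uncurry ⟨α.surfaceLift (C := C(unitInterval, α.Surface))
    -- Put s = min 1 (2u). The ends of a ribbon move to the strip coordinates -4s and 1 + 4s, where
    -- the strip meets the disc at radius 1 - 4s (cut off at 0); this is the scaling of the disc. At
    -- s = 1 the ribbon is stretched over [-4, 5] by q ↦ 9q - 4.
    (fun i z => ContinuousMap.curry ⟨fun q : Disc × unitInterval =>
      α.discPt i (scaleDisc (clampI (1 - 4 * min 1 (2 * (q.2 : ℝ)))) q.1), by
        have hI := continuous_clampI
        exact (α.continuous_discPt _).comp (continuous_scaleDisc.comp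
          (Continuous.prodMk (by fun_prop) (by fun_prop)))⟩ z)
    (fun x r => ContinuousMap.curry ⟨fun q : Ribbon × unitInterval =>
      α.strip x (q.1.1 + min 1 (2 * (q.2 : ℝ)) * (8 * q.1.1 - 4), min 1 (2 - 2 * (q.2 : ℝ)) * q.1.2), by
        have := α.continuous_strip x
        fun_prop⟩ r)
    (by
      intro x t
      ext u
      have h0 : (0 : ℝ) ≤ min 1 (2 * (u : ℝ)) := le_min zero_le_one (by linarith [u.2.1])
      simp only [ContinuousMap.curry_apply, ContinuousMap.coe_mk, Set.Icc.coe_zero]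
      rw [strip_of_le_zero _ _ _ (by linarith)]
      -- In the first half the transverse coordinate is unchanged; in the second half both sides are
      -- already at the crossing, where this coordinate does not matter.
      rcases le_total (2 * (u : ℝ)) 1 with h | h
      · rw [min_eq_left (a := (1 : ℝ)) (b := 2 - 2 * (u : ℝ)) (by linarith), one_mul, clampT_coe]
        congr 3
        ring
      · rw [min_eq_left h, clampI_of_nonpos (by norm_num), clampI_of_nonpos (by norm_num),
          discPt_scaleDisc_zero, discPt_scaleDisc_zero])
    (by
      intro x t
      ext u
      have h0 : (0 : ℝ) ≤ min 1 (2 * (u : ℝ)) := le_min zero_le_one (by linarith [u.2.1])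
      simp only [ContinuousMap.curry_apply, ContinuousMap.coe_mk, Set.Icc.coe_one]
      rw [strip_of_one_le _ _ _ (by linarith)]
      rcases le_total (2 * (u : ℝ)) 1 with h | h
      · rw [min_eq_left (a := (1 : ℝ)) (b := 2 - 2 * (u : ℝ)) (by linarith), one_mul, clampT_coe]
        congr 3
        ring
      · rw [min_eq_left h, clampI_of_nonpos (by norm_num), clampI_of_nonpos (by norm_num),
          discPt_scaleDisc_zero, discPt_scaleDisc_zero]),
    α.continuous_surfaceLift _ _ _ _ (fun i => ContinuousMap.continuous _)
      (fun x => ContinuousMap.continuous _)⟩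

theorem deformation_discPt (i : E) (z : Disc) (u : unitInterval) :
    α.deformation (α.discPt i z, u) =
      α.discPt i (scaleDisc (clampI (1 - 4 * min 1 (2 * (u : ℝ)))) z) := rfl

theorem deformation_ribbonPt (x : p.Pos) (q : Ribbon) (u : unitInterval) :
    α.deformation (α.ribbonPt x q, u) =
      α.strip x (q.1 + min 1 (2 * (u : ℝ)) * (8 * q.1 - 4), min 1 (2 - 2 * (u : ℝ)) * q.2) := rfl

theorem deformation_zero (z : α.Surface) : α.deformation (z, 0) = z := by
  revert z
  refine α.surface_cases (fun i z => ?_) (fun x q => ?_)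
  · rw [deformation_discPt, clampI_of_one_le (by simp), scaleDisc_one]
  · rw [deformation_ribbonPt]
    simp only [Set.Icc.coe_zero, mul_zero, sub_zero, zero_le_one, inf_of_le_right, zero_mul,
      add_zero, Nat.one_le_ofNat, inf_of_le_left, one_mul]
    rw [strip_of_mem _ _ _ q.1.2.1 q.1.2.2, clampI_coe, clampT_coe]

theorem deformation_one_discPt (i : E) (z : Disc) :
    α.deformation (α.discPt i z, 1) = α.crossing i := by
  rw [deformation_discPt, clampI_of_nonpos (by norm_num), discPt_scaleDisc_zero]

theorem deformation_one_ribbonPt (x : p.Pos) (q : Ribbon) :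
    α.deformation (α.ribbonPt x q, 1) = α.strip x (9 * q.1 - 4, 0) := by
  rw [deformation_ribbonPt]
  congr 2
  · norm_num
    ring
  · norm_num

/-- The middle line of a strip. -/
def midLine (x : p.Pos) : C(ℝ, α.Surface) :=
  ⟨fun y => α.strip x (y, 0), (α.continuous_strip x).comp (by fun_prop)⟩

theorem midLine_apply (x : p.Pos) (y : ℝ) : α.midLine x y = α.strip x (y, 0) := rfl

theorem pathClass_segPath_midLine_of_le (x : p.Pos) {a b : ℝ} (ha : a ≤ -1) (hb : b ≤ -1) :
    pathClass (segPath (α.midLine x) a b) = 0 :=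
  pathClass_const _ fun s => by
    have hs := s.2
    rw [segPath_apply, midLine_apply, midLine_apply, α.strip_of_le_neg_one x 0 ha,
      α.strip_of_le_neg_one]
    simp only [smul_eq_mul]
    nlinarith [hs.1, hs.2]

theorem pathClass_segPath_midLine_of_ge (x : p.Pos) {a b : ℝ} (ha : 2 ≤ a) (hb : 2 ≤ b) :
    pathClass (segPath (α.midLine x) a b) = 0 :=
  pathClass_const _ fun s => by
    have hs := s.2
    rw [segPath_apply, midLine_apply, midLine_apply, α.strip_of_two_le x 0 ha,
      α.strip_of_two_le]
    simp only [smul_eq_mul]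
    nlinarith [hs.1, hs.2]

theorem pathClass_edgePath_eq_add (x : p.Pos) : pathClass (α.edgePath x) =
    pathClass (α.pathOut x) + pathClass (α.pathRibbon x) + pathClass (α.pathIn x) := by
  rw [edgePath, pathClass_trans, pathClass_trans]

/-- The strip is constant on [-4, -1] and on [2, 5]; the intervals between -1, 0, 1, 2 give the
three parts of the edge. -/
theorem pathClass_segPath_midLine (x : p.Pos) :
    pathClass (segPath (α.midLine x) (-4) 5) = pathClass (α.edgePath x) := by
  have e1 : pathClass (segPath (α.midLine x) (-1) 0) = pathClass (α.pathOut x) :=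
    pathClass_congr _ _ fun s => by
      rw [segPath_apply, midLine_apply, α.strip_of_le_zero]
      · change _ = α.discPt _ _
        congr 1
        rw [show 1 + ((1 - (s : ℝ)) • (-1 : ℝ) + (s : ℝ) • (0 : ℝ)) = s by simp, clampI_coe,
          clampT_zero]
        ext
        simp [scaleDisc, outEnd, mid]
      · simp only [smul_eq_mul]
        linarith [s.2.2]
  have e2 : pathClass (segPath (α.midLine x) 0 1) = pathClass (α.pathRibbon x) :=
    pathClass_congr _ _ fun s => by
      rw [segPath_apply, midLine_apply, show (1 - (s : ℝ)) • (0 : ℝ) + (s : ℝ) • (1 : ℝ) = s by simp,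
        α.strip_of_mem _ _ s.2.1 s.2.2, clampI_coe, clampT_zero]
      rfl
  have e3 : pathClass (segPath (α.midLine x) 1 2) = pathClass (α.pathIn x) :=
    pathClass_congr _ _ fun s => by
      rw [segPath_apply, midLine_apply, α.strip_of_one_le]
      · change _ = α.discPt _ _
        congr 1
        have h : 2 - ((1 - (s : ℝ)) • (1 : ℝ) + (s : ℝ) • (2 : ℝ)) = (unitInterval.symm s : ℝ) := by
          simp only [smul_eq_mul, unitInterval.coe_symm_eq]
          ring
        rw [h, clampI_coe, clampT_zero]
        ext
        simp [scaleDisc, inEnd, mid]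
      · simp only [smul_eq_mul]
        linarith [s.2.1]
  rw [← pathClass_segPath_add _ (-4) (-1) 5, ← pathClass_segPath_add _ (-1) 0 5,
    ← pathClass_segPath_add _ 0 1 5, ← pathClass_segPath_add _ 1 2 5,
    pathClass_segPath_midLine_of_le (a := -4) (b := -1) _ _ (by norm_num) (by norm_num),
    pathClass_segPath_midLine_of_ge (a := 2) (b := 5) _ _ (by norm_num) (by norm_num), e1, e2, e3,
    pathClass_edgePath_eq_add]
  abel

end VirtualString

/-! ### Homology classes as combinations of edges of the curve -/

namespace VirtualString

variable {E : Type} {N : ℕ} {p : GaussParagraph E N} (α : VirtualString p)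

/-- The disc of a crossing together with the adjacent ends of ribbons. -/
def vertexStar (i : E) : Set α.Surface :=
  {z | α.surfaceLift (C := Prop) (fun j _ => j = i)
    (fun x q => ((q.1 : ℝ) < 1 / 3 ∧ p.letter x = i) ∨
      (2 / 3 < (q.1 : ℝ) ∧ p.letter (p.next x) = i))
    (fun x t => by norm_num) (fun x t => by norm_num) z}

theorem discPt_mem_vertexStar {i j : E} {z : Disc} : α.discPt j z ∈ α.vertexStar i ↔ j = i :=
  Iff.rfl

theorem ribbonPt_mem_vertexStar {i : E} {x : p.Pos} {q : Ribbon} :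
    α.ribbonPt x q ∈ α.vertexStar i ↔ ((q.1 : ℝ) < 1 / 3 ∧ p.letter x = i) ∨
      (2 / 3 < (q.1 : ℝ) ∧ p.letter (p.next x) = i) := Iff.rfl

theorem isOpen_vertexStar (i : E) : IsOpen (α.vertexStar i) := by
  refine α.isOpen_surface (fun j => isOpen_const (p := j = i)) (fun x => ?_)
  have h : Continuous fun q : Ribbon => (q.1 : ℝ) := by fun_prop
  exact IsOpen.union
    (IsOpen.inter (isOpen_lt h continuous_const) (isOpen_const (p := p.letter x = i)))
    (IsOpen.inter (isOpen_lt continuous_const h) (isOpen_const (p := p.letter (p.next x) = i)))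

/-- The part of a ribbon which lies outside the discs. -/
def ribbonInterior (x : p.Pos) : Set α.Surface :=
  {z | α.surfaceLift (C := Prop) (fun _ _ => False)
    (fun y q => y = x ∧ 0 < (q.1 : ℝ) ∧ (q.1 : ℝ) < 1)
    (fun x t => by simp) (fun x t => by simp) z}

theorem ribbonPt_mem_ribbonInterior {x y : p.Pos} {q : Ribbon} :
    α.ribbonPt y q ∈ α.ribbonInterior x ↔ y = x ∧ 0 < (q.1 : ℝ) ∧ (q.1 : ℝ) < 1 := Iff.rfl

theorem isOpen_ribbonInterior (x : p.Pos) : IsOpen (α.ribbonInterior x) := by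
  refine α.isOpen_surface (fun j => isOpen_const (p := False)) (fun y => ?_)
  have h : Continuous fun q : Ribbon => (q.1 : ℝ) := by fun_prop
  exact IsOpen.inter (isOpen_const (p := y = x))
    (IsOpen.inter (isOpen_lt continuous_const h) (isOpen_lt h continuous_const))

theorem exists_eq_of_mem_ribbonInterior {x : p.Pos} {z : α.Surface} (hz : z ∈ α.ribbonInterior x) :
    ∃ q : Ribbon, z = α.ribbonPt x q ∧ 0 < (q.1 : ℝ) ∧ (q.1 : ℝ) < 1 := by
  revert hz
  refine α.surface_cases (C := fun z => z ∈ α.ribbonInterior x →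
    ∃ q : Ribbon, z = α.ribbonPt x q ∧ 0 < (q.1 : ℝ) ∧ (q.1 : ℝ) < 1) (fun i z hz => ?_)
    (fun y q hz => ?_) z
  · exact hz.elim
  · obtain ⟨rfl, h⟩ := α.ribbonPt_mem_ribbonInterior.1 hz
    exact ⟨q, rfl, h⟩

theorem exists_mem_cover (z : α.Surface) :
    ∃ k : E ⊕ p.Pos, z ∈ Sum.elim α.vertexStar α.ribbonInterior k := by
  revert z
  refine α.surface_cases (fun i z => ⟨Sum.inl i, rfl⟩) (fun x q => ?_)
  rcases q.1.2.1.eq_or_lt with h | h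
  · exact ⟨Sum.inl _, α.ribbonPt_mem_vertexStar.2 (Or.inl ⟨by rw [← h]; norm_num, rfl⟩)⟩
  rcases q.1.2.2.eq_or_lt with h' | h'
  · exact ⟨Sum.inl _, α.ribbonPt_mem_vertexStar.2 (Or.inr ⟨by rw [h']; norm_num, rfl⟩)⟩
  · exact ⟨Sum.inr x, α.ribbonPt_mem_ribbonInterior.2 ⟨rfl, h, h'⟩⟩

open Classical in
/-- The map of the surface to the circle which winds the ribbon `x` around the circle. -/
def circleMap (x : p.Pos) : C(α.Surface, AddCircle (1 : ℝ)) :=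
  ⟨α.surfaceLift (fun _ _ => 0) (fun y q => if y = x then ((q.1 : ℝ) : AddCircle (1 : ℝ)) else 0)
      (by simp) (by simp [AddCircle.coe_period]),
    α.continuous_surfaceLift _ _ _ _ (fun _ => continuous_const) (fun y => by
      split_ifs
      · exact (AddCircle.continuous_mk' 1).comp (by fun_prop)
      · exact continuous_const)⟩

open Classical in
theorem circleMap_ribbonPt (x y : p.Pos) (q : Ribbon) : α.circleMap x (α.ribbonPt y q) =
    if y = x then ((q.1 : ℝ) : AddCircle (1 : ℝ)) else 0 := rfl

/-- The longitudinal coordinate on a ribbon. -/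
def coord (x : p.Pos) (z : α.Surface) : ℝ := AddCircle.equivIco (1 : ℝ) 0 (α.circleMap x z)

theorem coord_ribbonPt (x : p.Pos) (q : Ribbon) (h : (q.1 : ℝ) < 1) :
    α.coord x (α.ribbonPt x q) = q.1 := by
  have h1 : (q.1 : ℝ) ∈ Set.Ico (0 : ℝ) (0 + 1) := ⟨q.1.2.1, by simpa using h⟩
  rw [coord, circleMap_ribbonPt, if_pos rfl, AddCircle.equivIco_coe_eq h1]

/-- The representative in [0, 1) of a point of the circle is discontinuous only at 0, and
`circleMap` avoids 0 in the interior of the ribbon. -/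
theorem continuousAt_coord (x : p.Pos) {z : α.Surface} (hz : z ∈ α.ribbonInterior x) :
    ContinuousAt (α.coord x) z := by
  obtain ⟨q, rfl, h0, h1⟩ := α.exists_eq_of_mem_ribbonInterior hz
  have h2 : α.circleMap x (α.ribbonPt x q) ≠ ((0 : ℝ) : AddCircle (1 : ℝ)) := by
    rw [circleMap_ribbonPt, if_pos rfl]
    intro h
    have h3 : (q.1 : ℝ) ∈ Set.Ico (0 : ℝ) (0 + 1) := ⟨q.1.2.1, by simpa using h1⟩
    have h4 : (0 : ℝ) ∈ Set.Ico (0 : ℝ) (0 + 1) := by simp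
    exact h0.ne' ((AddCircle.coe_eq_coe_iff_of_mem_Ico h3 h4).1 h)
  exact continuous_subtype_val.continuousAt.comp
    ((AddCircle.continuousAt_equivIco (1 : ℝ) 0 h2).comp (α.circleMap x).continuous.continuousAt)

/-- The subgroup generated by the edges of the curve. -/
def edgeSpan : Submodule ℤ (ChainQuot α.Surface) :=
  Submodule.span ℤ (Set.range fun x => pathClass (α.edgePath x))

/-- The class of the part of the middle line of a strip up to a point, modulo the edges. -/
def midLineClass (x : p.Pos) (y : ℝ) : ChainQuot α.Surface ⧸ α.edgeSpan :=
  α.edgeSpan.mkQ (pathClass (segPath (α.midLine x) (-4) y))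

theorem midLineClass_of_le (x : p.Pos) {y : ℝ} (h : y ≤ -1) : α.midLineClass x y = 0 := by
  rw [midLineClass, α.pathClass_segPath_midLine_of_le x (by norm_num) h, map_zero]

/-- Here the whole edge has been traversed, which is zero modulo `edgeSpan`. So the potential can be
0 at both ends of a ribbon. -/
theorem midLineClass_of_ge (x : p.Pos) {y : ℝ} (h : 2 ≤ y) : α.midLineClass x y = 0 := by
  have h1 := pathClass_segPath_add (α.midLine x) (-4) y 5
  rw [α.pathClass_segPath_midLine_of_ge x h (by norm_num), add_zero,
    pathClass_segPath_midLine] at h1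
  rw [midLineClass, h1, Submodule.mkQ_apply, Submodule.Quotient.mk_eq_zero]
  exact Submodule.subset_span ⟨x, rfl⟩

/-- The potential of the deformed points. -/
def deformedPotential : α.Surface → ChainQuot α.Surface ⧸ α.edgeSpan :=
  α.surfaceLift (fun _ _ => 0) (fun x q => α.midLineClass x (9 * q.1 - 4))
    (fun x t => α.midLineClass_of_le x (by norm_num))
    (fun x t => α.midLineClass_of_ge x (by norm_num))

theorem deformedPotential_ribbonPt (x : p.Pos) (q : Ribbon) :
    α.deformedPotential (α.ribbonPt x q) = α.midLineClass x (9 * q.1 - 4) := rfl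

/-- The thresholds 1/3 and 2/3 of the star are sent by q ↦ 9q - 4 to -1 and 2, beyond which the
strip is constant. So the deformation collapses an open neighbourhood of the disc to the crossing.
-/
theorem of_mem_vertexStar {i : E} {z : α.Surface} (hz : z ∈ α.vertexStar i) :
    α.deformation (z, 1) = α.crossing i ∧ α.deformedPotential z = 0 := by
  revert hz
  refine α.surface_cases (C := fun z => z ∈ α.vertexStar i →
    α.deformation (z, 1) = α.crossing i ∧ α.deformedPotential z = 0) (fun j z hz => ?_)
    (fun x q hz => ?_) z
  · obtain rfl := α.discPt_mem_vertexStar.1 hz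
    exact ⟨α.deformation_one_discPt _ _, rfl⟩
  · rw [deformation_one_ribbonPt, deformedPotential_ribbonPt]
    rcases α.ribbonPt_mem_vertexStar.1 hz with ⟨h, rfl⟩ | ⟨h, rfl⟩
    · exact ⟨α.strip_of_le_neg_one x 0 (by linarith), α.midLineClass_of_le x (by linarith)⟩
    · exact ⟨α.strip_of_two_le x 0 (by linarith), α.midLineClass_of_ge x (by linarith)⟩


/-- The potential of the points of the surface. -/
def potential (z : α.Surface) : ChainQuot α.Surface ⧸ α.edgeSpan :=
  α.deformedPotential z - α.edgeSpan.mkQ (pathClass (trackPath α.deformation z))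

theorem mkQ_pathClass_eq {z w : α.Surface} (γ : Path z w) :
    α.edgeSpan.mkQ (pathClass γ) = α.edgeSpan.mkQ (pathClass (trackPath α.deformation z)) +
      α.edgeSpan.mkQ (pathClass (slicePath α.deformation 1 γ)) -
      α.edgeSpan.mkQ (pathClass (trackPath α.deformation w)) := by
  have h := congrArg α.edgeSpan.mkQ (pathClass_homotopy α.deformation γ)
  have h0 : pathClass (slicePath α.deformation 0 γ) = pathClass γ :=
    pathClass_congr _ _ fun s => α.deformation_zero _
  rw [h0, map_add, map_add] at h
  rw [← h, add_sub_cancel_right]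

/-- By subdivision only paths in a star or in a ribbon matter. The deformation replaces such a path,
up to the tracks of its ends, by a constant path or by a path on a middle line. -/
theorem mkQ_pathClass_eq_potential {z w : α.Surface} (γ : Path z w) :
    α.edgeSpan.mkQ (pathClass γ) = α.potential w - α.potential z := by
  refine map_pathClass_eq_of_cover α.edgeSpan.mkQ α.potential
    (Sum.elim α.vertexStar α.ribbonInterior) ?_ α.exists_mem_cover ?_ γ
  · rintro (i | x)
    · exact α.isOpen_vertexStar i
    · exact α.isOpen_ribbonInterior x
  · intro k z w γ hγ
    -- The tracks of the end points are already part of `potential`.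
    suffices h : α.edgeSpan.mkQ (pathClass (slicePath α.deformation 1 γ)) =
        α.deformedPotential w - α.deformedPotential z by
      rw [mkQ_pathClass_eq, h, potential, potential]
      abel
    have hz : z ∈ Sum.elim α.vertexStar α.ribbonInterior k := by simpa using hγ 0
    have hw : w ∈ Sum.elim α.vertexStar α.ribbonInterior k := by simpa using hγ 1
    rcases k with i | x
    · rw [(α.of_mem_vertexStar hz).2, (α.of_mem_vertexStar hw).2, sub_zero, pathClass_const,
        map_zero]
      intro s
      exact (α.of_mem_vertexStar (hγ s)).1.trans (α.of_mem_vertexStar hz).1.symm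
    -- The deformed path factors through the real parameter of the middle line, so it is equivalent
    -- to a segment of it.
    · have hc : Continuous fun s => α.coord x (γ s) :=
        continuous_iff_continuousAt.2 fun s =>
          ContinuousAt.comp (f := γ) (α.continuousAt_coord x (hγ s)) γ.continuous.continuousAt
      have hd : ∀ v ∈ α.ribbonInterior x, α.deformation (v, 1) = α.midLine x (9 * α.coord x v - 4) ∧
          α.deformedPotential v = α.midLineClass x (9 * α.coord x v - 4) := by
        intro v hv
        obtain ⟨q, rfl, h0, h1⟩ := α.exists_eq_of_mem_ribbonInterior hv
        rw [coord_ribbonPt _ _ _ h1, deformation_one_ribbonPt]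
        exact ⟨rfl, rfl⟩
      let g : Path (9 * α.coord x z - 4) (9 * α.coord x w - 4) :=
        { toFun := fun s => 9 * α.coord x (γ s) - 4
          continuous_toFun := by fun_prop
          source' := by simp
          target' := by simp }
      rw [pathClass_map_eq_segPath (α.midLine x) g _ fun s => (hd _ (hγ s)).1, (hd z hz).2,
        (hd w hw).2, midLineClass, midLineClass, ← map_sub, eq_sub_of_add_eq'
          (pathClass_segPath_add (α.midLine x) (-4) (9 * α.coord x z - 4) (9 * α.coord x w - 4))]

/-- The homology of the surface consists of combinations of edges. -/
theorem homologyInclusion_mem_edgeSpan (c : H1 α.Surface) :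
    homologyInclusion α.Surface c ∈ α.edgeSpan := by
  have := map_homologyInclusion_eq_zero α.edgeSpan.mkQ α.potential
    (fun _ _ γ => α.mkQ_pathClass_eq_potential γ) c
  simpa using this

open Classical in
/-- The coefficient of an edge. -/
theorem exists_edgeCoefficient (x : p.Pos) : ∃ W : ChainQuot α.Surface →ₗ[ℤ] ℝ,
    ∀ y, W (pathClass (α.edgePath y)) = if y = x then 1 else 0 := by
  obtain ⟨W, hW⟩ := exists_winding (α.circleMap x)
  refine ⟨W, fun y => ?_⟩
  -- The circle map is constant on the discs and on all ribbons except `x`.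
  have h1 : W (pathClass (α.pathOut y)) = 0 := by
    rw [hW _ _ _ (ContinuousMap.const _ 0) fun s => rfl]
    simp
  have h2 : W (pathClass (α.pathIn y)) = 0 := by
    rw [hW _ _ _ (ContinuousMap.const _ 0) fun s => rfl]
    simp
  have h3 : W (pathClass (α.pathRibbon y)) = if y = x then 1 else 0 := by
    split_ifs with h
    · rw [hW _ _ _ ⟨fun s => (s : ℝ), by fun_prop⟩ fun s => ?_]
      · simp
      · exact (if_pos h).symm
    · rw [hW _ _ _ (ContinuousMap.const _ 0) fun s => ?_]
      · simp
      · exact (if_neg h).symm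
  rw [pathClass_edgePath_eq_add, map_add, map_add, h1, h2, h3, zero_add, add_zero]

theorem pathClass_curve (n : Fin N) (a : ZMod (p.len n)) (k : ℕ) :
    pathClass (α.curve n a k) =
      ∑ j ∈ Finset.range k, pathClass (α.edgePath ⟨n, a + (j : ZMod (p.len n))⟩) := by
  induction k with
  | zero => rw [curve, pathClass_cast, pathClass_refl, Finset.sum_range_zero]
  | succ k ih => rw [curve, pathClass_trans, pathClass_cast, ih, Finset.sum_range_succ]

open Classical in
/-- The coefficient of a crossing. -/
theorem exists_crossingCoefficient (i : E) : ∃ F : (singularChains α.Surface).X 0 →ₗ[ℤ] ℤ,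
    ∀ j, F ((pointChain (α.crossing j)).hom (1 : ℤ)) = if j = i then 1 else 0 := by
  obtain ⟨F, hF⟩ := exists_pointCoefficient (α.vertexStar i)
  refine ⟨F, fun j => ?_⟩
  rw [hF, Set.indicator_apply]
  rfl

end VirtualString

/-! ### Integral chains of edges and their jumps -/

namespace GaussParagraph

variable {E : Type} {N : ℕ} (p : GaussParagraph E N)

/-- The position before `x` in its word. -/
def prev (x : p.Pos) : p.Pos := ⟨x.1, x.2 - 1⟩

theorem prev_next (x : p.Pos) : p.prev (p.next x) = x :=
  Sigma.ext rfl (heq_of_eq (add_sub_cancel_right _ _))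

theorem next_prev (x : p.Pos) : p.next (p.prev x) = x :=
  Sigma.ext rfl (heq_of_eq (sub_add_cancel _ _))

/-- The passage to the next position. -/
def nextEquiv : p.Pos ≃ p.Pos := ⟨p.next, p.prev, p.prev_next, p.next_prev⟩

/-- The change of an integral chain of edges at a position. -/
def jump : (p.Pos → ℤ) →ₗ[ℤ] p.Pos → ℤ :=
  LinearMap.id - LinearMap.funLeft ℤ ℤ p.prev

theorem jump_apply (z : p.Pos → ℤ) (x : p.Pos) : p.jump z x = z x - z (p.prev x) := rfl

open Classical in
theorem jump_single (x : p.Pos) :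
    p.jump (Pi.single x 1) = Pi.single x 1 - Pi.single (p.next x) 1 := by
  funext y
  rw [jump_apply, Pi.sub_apply]
  congr 1
  by_cases h : y = p.next x
  · subst h
    rw [prev_next, Pi.single_eq_same, Pi.single_eq_same]
  · rw [Pi.single_eq_of_ne h, Pi.single_eq_of_ne]
    rintro rfl
    exact h (p.next_prev y).symm

open Classical in
/-- The chain of `k` consecutive edges of a word. -/
def runVec (n : Fin N) (a : ZMod (p.len n)) (k : ℕ) : p.Pos → ℤ :=
  ∑ j ∈ Finset.range k, Pi.single ⟨n, a + (j : ZMod (p.len n))⟩ 1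

open Classical in
theorem jump_runVec (n : Fin N) (a : ZMod (p.len n)) (k : ℕ) : p.jump (p.runVec n a k) =
    Pi.single ⟨n, a⟩ 1 - Pi.single ⟨n, a + (k : ZMod (p.len n))⟩ 1 := by
  induction k with
  | zero => simp [runVec]
  | succ k ih =>
    rw [runVec, Finset.sum_range_succ, map_add]
    rw [runVec] at ih
    rw [ih, jump_single]
    simp [next, add_assoc]

/-- The chain of the arc from `a` to `b`. -/
def arcVec (n : Fin N) (a b : ZMod (p.len n)) : p.Pos → ℤ := p.runVec n a (b - a).val

open Classical in
theorem jump_arcVec (n : Fin N) (a b : ZMod (p.len n)) : p.jump (p.arcVec n a b) =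
    Pi.single ⟨n, a⟩ 1 - Pi.single ⟨n, b⟩ 1 := by
  rw [arcVec, jump_runVec]
  simp

/-- The chain of a word. -/
def circleVec (n : Fin N) : p.Pos → ℤ := p.runVec n 0 (p.len n)

theorem jump_circleVec (n : Fin N) : p.jump (p.circleVec n) = 0 := by
  rw [circleVec, jump_runVec]
  simp

theorem eq_of_jump_eq_zero {z : p.Pos → ℤ} (hz : p.jump z = 0) (n : Fin N) (k : ZMod (p.len n)) :
    z ⟨n, k⟩ = z ⟨n, 0⟩ := by
  have h : ∀ j : ℕ, z ⟨n, (j : ZMod (p.len n))⟩ = z ⟨n, 0⟩ := by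
    intro j
    induction j with
    | zero => simp
    | succ j ih =>
      have := congrFun hz ⟨n, ((j + 1 : ℕ) : ZMod (p.len n))⟩
      rw [jump_apply, Pi.zero_apply, sub_eq_zero] at this
      rw [this, ← ih]
      simp [prev]
  have := h k.val
  rwa [ZMod.natCast_zmod_val] at this

open Classical in
theorem circleVec_zero (m n : Fin N) : p.circleVec n ⟨m, 0⟩ = if m = n then 1 else 0 := by
  rw [circleVec, runVec, Finset.sum_apply]
  split_ifs with h
  · subst h
    rw [Finset.sum_eq_single 0]
    · simp
    · intro j hj hj0
      refine Pi.single_eq_of_ne (fun h => hj0 ?_) _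
      simp only [zero_add, Sigma.mk.injEq, heq_eq_eq, true_and] at h
      have h1 := congrArg ZMod.val h
      rwa [ZMod.val_zero, ZMod.val_natCast_of_lt (Finset.mem_range.1 hj), eq_comm] at h1
    · intro h0
      exact absurd (Finset.mem_range.2 (p.len_pos m)) h0
  · refine Finset.sum_eq_zero fun j _ => Pi.single_eq_of_ne (fun h0 => h ?_) _
    exact congrArg Sigma.fst h0

/-- A chain without jumps is constant on each word, so its values at the positions 0 are its
coefficients. -/
theorem eq_sum_circleVec {z : p.Pos → ℤ} (hz : p.jump z = 0) :
    z = ∑ n, z ⟨n, 0⟩ • p.circleVec n := by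
  funext ⟨m, k⟩
  have hw : p.jump (∑ n, z ⟨n, 0⟩ • p.circleVec n) = 0 := by
    rw [map_sum]
    exact Finset.sum_eq_zero fun n _ => by rw [map_smul, jump_circleVec, smul_zero]
  rw [p.eq_of_jump_eq_zero hz, p.eq_of_jump_eq_zero hw, Finset.sum_apply]
  simp [circleVec_zero]

/-- The jumps of a chain sum up to zero on each word. -/
theorem sum_jump_eq_zero (z : p.Pos → ℤ) (c : Fin N → ℤ) : ∑ x, c x.1 * p.jump z x = 0 := by
  have h : ∑ x, c x.1 * z (p.prev x) = ∑ x, c x.1 * z x :=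
    Equiv.sum_comp p.nextEquiv.symm (fun x => c x.1 * z x)
  simp only [jump_apply, mul_sub, Finset.sum_sub_distrib]
  rw [h, sub_self]

end GaussParagraph

/-! ### Flow along arrows and comparison with singular chains -/

namespace VirtualString

variable {E : Type} {N : ℕ} {p : GaussParagraph E N} (α : VirtualString p)

theorem tail_ne_head' (i j : E) : α.tail i ≠ α.head j := by
  intro h
  have := congrArg p.letter h
  rw [α.letter_tail, α.letter_head] at this
  subst this
  exact α.tail_ne_head i h

theorem tail_injective : Function.Injective α.tail := fun i j h => by
  rw [← α.letter_tail i, h, α.letter_tail]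

theorem head_injective : Function.Injective α.head := fun i j h => by
  rw [← α.letter_head i, h, α.letter_head]

theorem eq_tail_or_eq_head {x : p.Pos} {i : E} (h : p.letter x = i) :
    x = α.tail i ∨ x = α.head i :=
  p.eq_or_eq_of_letter (α.tail_ne_head i) ((α.letter_tail i).trans (α.letter_head i).symm)
    (h.trans (α.letter_head i).symm)

/-- The positions are the end points of the arrows. -/
def endsEquiv : E ⊕ E ≃ p.Pos :=
  Equiv.ofBijective (Sum.elim α.tail α.head) (by
    constructor
    · rintro (i | i) (j | j) h
      · exact congrArg _ (α.tail_injective h)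
      · exact absurd h (α.tail_ne_head' i j)
      · exact absurd h.symm (α.tail_ne_head' j i)
      · exact congrArg _ (α.head_injective h)
    · intro x
      rcases α.eq_tail_or_eq_head (rfl : p.letter x = _) with h | h
      · exact ⟨Sum.inl _, h.symm⟩
      · exact ⟨Sum.inr _, h.symm⟩)

theorem sum_pos [Fintype E] {M : Type*} [AddCommMonoid M] (f : p.Pos → M) :
    ∑ x, f x = ∑ i, (f (α.tail i) + f (α.head i)) := by
  rw [← Equiv.sum_comp α.endsEquiv, Fintype.sum_sum_type, Finset.sum_add_distrib]
  rfl

/-- The cycles in the curve. -/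
def edgeCycles : Submodule ℤ (p.Pos → ℤ) where
  carrier := {z | ∀ i, p.jump z (α.tail i) + p.jump z (α.head i) = 0}
  add_mem' := by
    intro z w hz hw i
    have := hz i
    have := hw i
    simp only [map_add, Pi.add_apply]
    linarith
  zero_mem' := by simp
  smul_mem' := by
    intro c z hz i
    have := hz i
    simp only [map_smul, Pi.smul_apply, smul_eq_mul]
    rw [← mul_add, this, mul_zero]

/-- The flow of a chain along an arrow. -/
def flow (i : E) : (p.Pos → ℤ) →ₗ[ℤ] ℤ := LinearMap.proj (α.head i) ∘ₗ p.jump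

theorem flow_apply (i : E) (z : p.Pos → ℤ) : α.flow i z = p.jump z (α.head i) := rfl

theorem jump_tail {z : p.Pos → ℤ} (hz : z ∈ α.edgeCycles) (i : E) :
    p.jump z (α.tail i) = -α.flow i z := by
  have := hz i
  rw [flow_apply]
  linarith

theorem jump_eq_zero {z : p.Pos → ℤ} (hz : z ∈ α.edgeCycles) (h : ∀ i, α.flow i z = 0) :
    p.jump z = 0 := by
  funext x
  rcases α.eq_tail_or_eq_head (rfl : p.letter x = _) with hx | hx
  · rw [hx, α.jump_tail hz, h, neg_zero, Pi.zero_apply]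
  · rw [hx]
    exact h _

/-- The flow through a cut which contains only one arrow is zero. -/
theorem flow_eq_zero_of_cut [Finite E] {z : p.Pos → ℤ} (hz : z ∈ α.edgeCycles) {j : E}
    (W : Set (Fin N)) (hj : (α.tail j).1 ∈ W) (hj' : (α.head j).1 ∉ W)
    (h : ∀ i, i ≠ j → α.flow i z = 0 ∨ ((α.tail i).1 ∈ W ↔ (α.head i).1 ∈ W)) :
    α.flow j z = 0 := by
  have := Fintype.ofFinite E
  -- The jumps on the words in `W` sum to zero. An arrow with both ends on the same side of the cut
  -- contributes nothing, as its jumps cancel, so only the flow of `j` remains.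
  have h0 := p.sum_jump_eq_zero z (W.indicator 1)
  rw [α.sum_pos, Finset.sum_eq_single j] at h0
  · rw [Set.indicator_of_mem hj, Set.indicator_of_notMem hj', α.jump_tail hz] at h0
    simpa using h0
  · intro i _ hi
    rw [α.jump_tail hz, ← flow_apply]
    rcases h i hi with h | h
    · rw [h]
      simp
    · by_cases hW : (α.tail i).1 ∈ W
      · rw [Set.indicator_of_mem hW, Set.indicator_of_mem (h.1 hW)]
        simp
      · rw [Set.indicator_of_notMem hW, Set.indicator_of_notMem (mt h.2 hW)]
        simp
  · simp

/-! ### Chains of edges and singular chains -/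

/-- The singular chain given by a chain of edges. -/
def edgeChain : (p.Pos → ℤ) →+ ChainQuot α.Surface :=
  ∑ x, (zmultiplesHom _ (pathClass (α.edgePath x))).comp (Pi.evalAddMonoidHom _ x)

theorem edgeChain_apply (z : p.Pos → ℤ) :
    α.edgeChain z = ∑ x, zmultiplesHom _ (pathClass (α.edgePath x)) (z x) := by
  simp [edgeChain]

open Classical in
theorem edgeChain_single (x : p.Pos) : α.edgeChain (Pi.single x 1) = pathClass (α.edgePath x) := by
  rw [edgeChain_apply, Finset.sum_eq_single x]
  · rw [Pi.single_eq_same, zmultiplesHom_apply, one_zsmul]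
  · intro y _ hy
    rw [Pi.single_eq_of_ne hy, map_zero]
  · simp

theorem map_edgeChain {M : Type*} [AddCommGroup M] (F : ChainQuot α.Surface →+ M) (z : p.Pos → ℤ) :
    F (α.edgeChain z) = ∑ x, z x • F (pathClass (α.edgePath x)) := by
  simp only [edgeChain_apply, map_sum, zmultiplesHom_apply, map_zsmul]

/-- Winding around the ribbon `x` recovers the coefficient of the edge `x`. -/
theorem edgeChain_injective : Function.Injective α.edgeChain := by
  rw [injective_iff_map_eq_zero]
  intro z hz
  funext x
  obtain ⟨W, hW⟩ := α.exists_edgeCoefficient x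
  have h := α.map_edgeChain W.toAddMonoidHom z
  rw [hz, map_zero] at h
  simp only [LinearMap.toAddMonoidHom_coe, hW, smul_ite, smul_zero, Finset.sum_ite_eq',
    Finset.mem_univ, if_true] at h
  simpa using h.symm

theorem pathClass_curve_eq (n : Fin N) (a : ZMod (p.len n)) (k : ℕ) :
    pathClass (α.curve n a k) = α.edgeChain (p.runVec n a k) := by
  rw [pathClass_curve, GaussParagraph.runVec, map_sum]
  exact Finset.sum_congr rfl fun j _ => (α.edgeChain_single _).symm

theorem pathClass_arcPath_eq (n : Fin N) (a b : ZMod (p.len n)) :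
    pathClass (α.arcPath n a b) = α.edgeChain (p.arcVec n a b) := by
  rw [arcPath, pathClass_cast, pathClass_curve_eq]
  rfl

open Classical in
-- The sum of the two jumps at the letter `i` is, up to sign, the coefficient of the crossing `i` in
-- the boundary.
theorem mem_edgeCycles [Finite E] {z : p.Pos → ℤ} {c : H1 α.Surface}
    (h : α.edgeChain z = homologyInclusion α.Surface c) : z ∈ α.edgeCycles := by
  have := Fintype.ofFinite E
  intro i
  obtain ⟨F, hF⟩ := α.exists_crossingCoefficient i
  have h1 := α.map_edgeChain (F ∘ₗ chainBoundary α.Surface).toAddMonoidHom z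
  rw [h] at h1
  simp only [LinearMap.toAddMonoidHom_coe, LinearMap.comp_apply, chainBoundary_homologyInclusion,
    chainBoundary_pathClass, map_sub, hF, map_zero, smul_eq_mul, mul_sub,
    Finset.sum_sub_distrib] at h1
  have h2 : ∑ x, z x * (if p.letter (p.next x) = i then 1 else 0) =
      ∑ x, z (p.prev x) * (if p.letter x = i then (1 : ℤ) else 0) := by
    rw [← Equiv.sum_comp p.nextEquiv (fun x => z (p.prev x) * (if p.letter x = i then (1 : ℤ) else 0))]
    refine Finset.sum_congr rfl fun x _ => ?_
    change _ = z (p.prev (p.next x)) * (if p.letter (p.next x) = i then (1 : ℤ) else 0)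
    rw [p.prev_next]
  rw [h2, ← Finset.sum_sub_distrib, α.sum_pos, Finset.sum_eq_single i] at h1
  · simp only [α.letter_tail, α.letter_head, if_true, mul_one] at h1
    rw [GaussParagraph.jump_apply, GaussParagraph.jump_apply]
    linarith
  · intro j _ hj
    simp [α.letter_tail, α.letter_head, hj]
  · simp

theorem exists_edgeChain_eq (c : H1 α.Surface) :
    ∃ z, α.edgeChain z = homologyInclusion α.Surface c := by
  have h := α.homologyInclusion_mem_edgeSpan c
  rw [edgeSpan] at h
  generalize homologyInclusion α.Surface c = q at h ⊢
  induction h using Submodule.span_induction with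
  | mem q hq =>
    classical
    obtain ⟨x, rfl⟩ := hq
    exact ⟨_, α.edgeChain_single x⟩
  | zero => exact ⟨0, map_zero _⟩
  | add q r _ _ hq hr =>
    obtain ⟨z, rfl⟩ := hq
    obtain ⟨w, rfl⟩ := hr
    exact ⟨z + w, map_add _ _ _⟩
  | smul n q _ hq =>
    obtain ⟨z, rfl⟩ := hq
    -- Reconciles the module structure of `ChainQuot` with the multiples in its additive group.
    exact ⟨n • z, (map_zsmul _ _ _).trans (int_smul_eq_zsmul _ _ _).symm⟩

/-! ### The chains of the homology classes -/

theorem homologyInclusion_circleClass (n : Fin N) :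
    homologyInclusion α.Surface (α.circleClass n) = α.edgeChain (p.circleVec n) := by
  rw [circleClass, homologyInclusion_cycleClass]
  exact α.pathClass_curve_eq n 0 (p.len n)

open Classical in
theorem exists_arrowVec (i : E) (hi : ∃ n, p.IsDouble n i) : ∃ z,
    α.edgeChain z = homologyInclusion α.Surface (α.arrowClass i hi) ∧
    p.jump z = Pi.single (α.tail i) 1 - Pi.single (α.head i) 1 := by
  refine ⟨p.arcVec (α.tail i).1 (α.tail i).2 (α.head_fst_eq_tail_fst hi ▸ (α.head i).2), ?_, ?_⟩
  · rw [arrowClass, loopClass, homologyInclusion_cycleClass]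
    exact (α.pathClass_arcPath_eq _ _ _).symm
  · rw [p.jump_arcVec]
    have h : ∀ (x : p.Pos) (n : Fin N) (e : x.1 = n), (⟨n, e ▸ x.2⟩ : p.Pos) = x := by
      rintro x n rfl
      rfl
    rw [h]

open Classical in
theorem exists_cyclicVec {d : p.CyclicSequence} {M : ℕ} [NeZero M] {σ : ZMod M → Fin N}
    {a b : ∀ m, ZMod (p.len (σ m))} (h : p.IsCyclicArrangement d.arc M σ a b) : ∃ z,
    α.edgeChain z = homologyInclusion α.Surface (α.cyclicClass d) ∧
    p.jump z = ∑ m, (Pi.single ⟨σ m, a m⟩ 1 - Pi.single ⟨σ m, b m⟩ 1) := by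
  refine ⟨∑ m, p.arcVec (σ m) (a m) (b m), ?_, ?_⟩
  · have h1 : ∑ n, α.arcChain n (d.arc n) = ∑ m, α.arcChain (σ m) (d.arc (σ m)) := by
      refine (Finset.sum_of_injOn σ h.injective.injOn (by simp) ?_ (fun _ _ => rfl)).symm
      intro n _ hn
      rw [h.eq_none n (by simpa using hn)]
      rfl
    rw [cyclicClass, homologyInclusion_cycleClass, h1, chainClass_sum, map_sum]
    refine Finset.sum_congr rfl fun m _ => ?_
    rw [h.eq_some m]
    exact (α.pathClass_arcPath_eq _ _ _).symm
  · rw [map_sum]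
    exact Finset.sum_congr rfl fun m _ => p.jump_arcVec _ _ _

open Classical in
theorem flow_of_isAssociated {T : Set E} {i : E} {d : p.CyclicSequence}
    (h : α.IsAssociated T i d) : ∃ z,
    α.edgeChain z = homologyInclusion α.Surface (α.cyclicClass d) ∧
    ∀ j ∉ T, α.flow j z = if j = i then 1 else 0 := by
  obtain ⟨M, σ, a, b, hd, ht, hh, hT⟩ := h
  have : NeZero M := ⟨by have := hd.two_le; omega⟩
  obtain ⟨z, hz, hj⟩ := α.exists_cyclicVec hd
  refine ⟨z, hz, fun j hjT => ?_⟩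
  -- All crossings between arcs have letters in `T`, except the one from arc -1 to arc 0. So the
  -- head of a letter outside `T` can only be the beginning of arc 0.
  rw [flow_apply, hj, Finset.sum_apply, Finset.sum_eq_single 0]
  · rw [Pi.sub_apply, ← hh]
    have h1 : α.head j ≠ ⟨σ 0, b 0⟩ := by
      intro h
      by_cases h0 : (0 : ZMod M) + 1 = 0
      · have h2 : (-1 : ZMod M) = 0 := by rw [neg_eq_zero]; simpa using h0
        rw [h2] at ht
        exact α.tail_ne_head' i j (ht.trans h.symm)
      · have h2 := hT _ h0
        rw [hd.letter_eq] at h2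
        have h3 := congrArg p.letter h
        rw [α.letter_head] at h3
        exact hjT (h3 ▸ h2)
    rw [Pi.single_eq_of_ne h1, sub_zero]
    split_ifs with hji
    · rw [hji, Pi.single_eq_same]
    · exact Pi.single_eq_of_ne (fun h => hji (α.head_injective h)) _
  · intro m _ hm
    have h1 : α.head j ≠ ⟨σ m, a m⟩ := by
      intro h
      have h3 := congrArg p.letter h
      rw [α.letter_head] at h3
      exact hjT (h3 ▸ hT m hm)
    have h2 : α.head j ≠ ⟨σ m, b m⟩ := by
      intro h
      -- The arc -1 ends at the tail of `e_i`, and a tail is never a head; every other arc ends at a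
      -- letter of `T`.
      by_cases h0 : m + 1 = 0
      · obtain rfl : m = -1 := eq_neg_of_add_eq_zero_left h0
        exact α.tail_ne_head' i j (ht.trans h.symm)
      · have h2 := hT _ h0
        rw [hd.letter_eq] at h2
        have h3 := congrArg p.letter h
        rw [α.letter_head] at h3
        exact hjT (h3 ▸ h2)
    rw [Pi.sub_apply, Pi.single_eq_of_ne h1, Pi.single_eq_of_ne h2, sub_zero]
  · simp

end VirtualString

/-! ### Existence of a spanning tree of the word graph -/

namespace GaussParagraph

variable {E : Type} {N : ℕ} (p : GaussParagraph E N)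

theorem exists_eq_mk {x : p.Pos} {n : Fin N} (h : x.1 = n) :
    ∃ k : ZMod (p.len n), (⟨n, k⟩ : p.Pos) = x := by
  subst h
  exact ⟨x.2, rfl⟩

/-- The graph of words and letters without the distinction of parallel letters is connected. -/
theorem wordGraph_connected : p.wordGraph.toSimpleGraph.Connected := by
  let v (n : Fin N) : p.wordGraph.vertexSet := ⟨n, Set.mem_univ n⟩
  have : Nonempty p.wordGraph.vertexSet := ⟨v ⟨0, p.pos_N⟩⟩
  refine ⟨fun m n => ?_⟩
  by_contra hmn
  -- Some letter joins a word reachable from `m` to an unreachable one, which is absurd.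
  obtain ⟨x, y, hxy, hx, hy⟩ := p.connected {k | p.wordGraph.toSimpleGraph.Reachable m (v k)}
    ⟨m.1, SimpleGraph.Reachable.refl _⟩ ⟨n.1, hmn⟩
  refine hy (SimpleGraph.Reachable.trans hx (SimpleGraph.Adj.reachable ⟨?_, ?_⟩))
  · intro h
    have h1 : x.1 = y.1 := congrArg Subtype.val h
    exact hy (h1 ▸ hx)
  · refine ⟨p.letter x, x, y, ?_, rfl, hxy.symm, rfl, rfl⟩
    rintro rfl
    exact hy hx

/-- A spanning tree of the underlying simple graph is lifted by the choice of one letter above each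
of its edges. -/
theorem exists_isSpanningTree : ∃ T, p.IsSpanningTree T := by
  obtain ⟨F, hF, hT⟩ := p.wordGraph_connected.exists_isTree_le
  have h : ∀ e : F.edgeSet, ∃ i, ∀ m n, e.1 = s(m, n) → p.wordGraph.IsLink i m.1 n.1 := by
    rintro ⟨e, he⟩
    induction e with
    | h m n =>
      obtain ⟨i, hi⟩ := (hF he).2
      refine ⟨i, fun k l h => ?_⟩
      rcases Sym2.eq_iff.1 h with ⟨rfl, rfl⟩ | ⟨rfl, rfl⟩
      · exact hi
      · exact hi.symm
  choose c hc using h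
  -- A letter determines the words which it joins, so the chosen letters create no loops, parallel
  -- edges or new adjacencies.
  have key : ∀ (e : F.edgeSet) (m n : p.wordGraph.vertexSet), p.wordGraph.IsLink (c e) m.1 n.1 →
      e.1 = s(m, n) := by
    rintro ⟨e, he⟩ m n hmn
    induction e with
    | h k l =>
      have h := hc ⟨s(k, l), he⟩ k l rfl
      rcases (Graph.IsLink.eq_and_eq_or_eq_and_eq hmn h) with ⟨h1, h2⟩ | ⟨h1, h2⟩
      · rw [Subtype.ext h1, Subtype.ext h2]
      · rw [Subtype.ext h1, Subtype.ext h2]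
        exact Sym2.eq_swap
  refine ⟨Set.range c, ?_, ?_⟩
  · have hl : (p.wordGraph.restrict (Set.range c)).Loopless := by
      refine ⟨?_⟩
      rintro i m hm
      rw [← Graph.isLink_self_iff] at hm
      obtain ⟨⟨e, rfl⟩, hm⟩ := hm
      have h := key e ⟨m, Set.mem_univ m⟩ ⟨m, Set.mem_univ m⟩ hm
      have h2 := e.2
      rw [h] at h2
      exact F.loopless.irrefl _ h2
    refine { hl with eq_of_isLink := ?_ }
    rintro i j m n ⟨⟨e, rfl⟩, hi⟩ ⟨⟨f, rfl⟩, hj⟩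
    have h := (key e ⟨m, Set.mem_univ m⟩ ⟨n, Set.mem_univ n⟩ hi).trans
      (key f ⟨m, Set.mem_univ m⟩ ⟨n, Set.mem_univ n⟩ hj).symm
    rw [Subtype.ext h]
  · suffices h : ((p.wordGraph.restrict (Set.range c)).toSimpleGraph :
        SimpleGraph p.wordGraph.vertexSet) = F from h.symm ▸ hT
    ext m n
    constructor
    · rintro ⟨-, i, ⟨e, rfl⟩, h⟩
      have h1 := e.2
      rw [key e m n h] at h1
      exact h1
    · intro h
      exact ⟨h.ne, c ⟨s(m, n), h⟩, ⟨_, rfl⟩, hc ⟨s(m, n), h⟩ m n rfl⟩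

end GaussParagraph

/-! ### Cuts and cyclic sequences given by a spanning tree -/

namespace VirtualString

variable {E : Type} {N : ℕ} {p : GaussParagraph E N} (α : VirtualString p)

theorem isLink_tail_head (i : E) : p.wordGraph.IsLink i (α.tail i).1 (α.head i).1 :=
  ⟨_, _, α.tail_ne_head i, α.letter_tail i, α.letter_head i, rfl, rfl⟩

theorem isDouble_iff (n : Fin N) (i : E) :
    p.IsDouble n i ↔ (α.tail i).1 = n ∧ (α.head i).1 = n := by
  constructor
  · intro h
    obtain ⟨a, b, hab, h⟩ := Set.ncard_eq_two.1 h
    have ha : a ∈ {k | p.entry n k = i} := h ▸ Set.mem_insert a _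
    have hb : b ∈ {k | p.entry n k = i} := h ▸ Set.mem_insert_of_mem a rfl
    have ha' := α.eq_tail_or_eq_head ha
    have hb' := α.eq_tail_or_eq_head hb
    have hne : (⟨n, a⟩ : p.Pos) ≠ ⟨n, b⟩ := by simpa using hab
    rcases ha' with ha' | ha' <;> rcases hb' with hb' | hb'
    · exact absurd (ha'.trans hb'.symm) hne
    · exact ⟨congrArg Sigma.fst ha'.symm, congrArg Sigma.fst hb'.symm⟩
    · exact ⟨congrArg Sigma.fst hb'.symm, congrArg Sigma.fst ha'.symm⟩
    · exact absurd (ha'.trans hb'.symm) hne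
  · rintro ⟨h1, h2⟩
    obtain ⟨a, ha⟩ := p.exists_eq_mk h1
    obtain ⟨b, hb⟩ := p.exists_eq_mk h2
    refine Set.ncard_eq_two.2 ⟨a, b, ?_, ?_⟩
    · rintro rfl
      exact α.tail_ne_head i (ha.symm.trans hb)
    · ext k
      simp only [Set.mem_ofPred_eq, Set.mem_insert_iff, Set.mem_singleton_iff]
      constructor
      · intro hk
        rcases α.eq_tail_or_eq_head (x := ⟨n, k⟩) hk with h | h
        · exact Or.inl (by simpa using h.trans ha.symm)
        · exact Or.inr (by simpa using h.trans hb.symm)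
      · rintro (rfl | rfl)
        · exact (congrArg p.letter ha).trans (α.letter_tail i)
        · exact (congrArg p.letter hb).trans (α.letter_head i)

theorem exists_isDouble_iff (i : E) : (∃ n, p.IsDouble n i) ↔ (α.tail i).1 = (α.head i).1 := by
  simp only [α.isDouble_iff]
  exact ⟨fun ⟨n, h1, h2⟩ => h1.trans h2.symm, fun h => ⟨_, h, rfl⟩⟩

theorem exists_isSingle_iff (i : E) : (∃ n, p.IsSingle n i) ↔ (α.tail i).1 ≠ (α.head i).1 := by
  constructor
  · rintro ⟨n, hn⟩ h
    obtain ⟨k, hk⟩ := Set.ncard_eq_one.1 hn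
    have hk' : k ∈ {k | p.entry n k = i} := hk ▸ rfl
    have h1 : (α.tail i).1 = n ∧ (α.head i).1 = n := by
      rcases α.eq_tail_or_eq_head hk' with h' | h'
      · have := congrArg Sigma.fst h'
        exact ⟨this.symm, h.symm.trans this.symm⟩
      · have := congrArg Sigma.fst h'
        exact ⟨h.trans this.symm, this.symm⟩
    have h2 : p.count n i = 2 := (α.isDouble_iff n i).2 h1
    have h3 : p.count n i = 1 := hn
    omega
  · intro h
    refine ⟨(α.tail i).1, Set.ncard_eq_one.2 ⟨(α.tail i).2, ?_⟩⟩
    ext k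
    simp only [Set.mem_ofPred_eq, Set.mem_singleton_iff]
    constructor
    · intro hk
      rcases α.eq_tail_or_eq_head (x := ⟨(α.tail i).1, k⟩) hk with h' | h'
      · exact eq_of_heq (Sigma.mk.inj h').2
      · exact absurd (congrArg Sigma.fst h') h
    · rintro rfl
      exact α.letter_tail i

section SpanningTree

variable {T : Set E} (hT : p.IsSpanningTree T)
include hT

theorem tail_fst_ne_head_fst_of_mem {i : E} (hi : i ∈ T) : (α.tail i).1 ≠ (α.head i).1 := by
  intro h
  have := hT.1
  refine Graph.not_isLoopAt (p.wordGraph.restrict T) i (α.tail i).1 ?_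
  rw [← Graph.isLink_self_iff]
  refine ⟨hi, ?_⟩
  have := α.isLink_tail_head i
  rwa [← h] at this

/-- An edge of a spanning tree is the only one which connects the two sides of some cut. -/
theorem exists_cut {j : E} (hj : j ∈ T) : ∃ W : Set (Fin N), (α.tail j).1 ∈ W ∧ (α.head j).1 ∉ W ∧
    ∀ i ∈ T, i ≠ j → ((α.tail i).1 ∈ W ↔ (α.head i).1 ∈ W) := by
  have hs := hT.1
  let G := (p.wordGraph.restrict T).toSimpleGraph
  let v (n : Fin N) : (p.wordGraph.restrict T).vertexSet := ⟨n, Set.mem_univ n⟩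
  have hadj : ∀ i ∈ T, G.Adj (v (α.tail i).1) (v (α.head i).1) := fun i hi =>
    ⟨fun h => α.tail_fst_ne_head_fst_of_mem hT hi (congrArg Subtype.val h), i, hi,
      α.isLink_tail_head i⟩
  have hb : ¬ (G.deleteEdges {s(v (α.tail j).1, v (α.head j).1)}).Reachable
      (v (α.tail j).1) (v (α.head j).1) :=
    SimpleGraph.isAcyclic_iff_forall_adj_isBridge.1 hT.2.isAcyclic (hadj j hj)
  -- Every edge of a tree is a bridge; `W` is the side of the tail of `j` after its removal.
  refine ⟨{n | (G.deleteEdges {s(v (α.tail j).1, v (α.head j).1)}).Reachable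
    (v (α.tail j).1) (v n)}, SimpleGraph.Reachable.refl _, hb, fun i hi hij => ?_⟩
  have h : (G.deleteEdges {s(v (α.tail j).1, v (α.head j).1)}).Adj
      (v (α.tail i).1) (v (α.head i).1) := by
    rw [SimpleGraph.deleteEdges_adj]
    refine ⟨hadj i hi, fun h => hij ?_⟩
    have hj' : (p.wordGraph.restrict T).IsLink j (α.tail j).1 (α.head j).1 :=
      ⟨hj, α.isLink_tail_head j⟩
    have hi' : (p.wordGraph.restrict T).IsLink i (α.tail i).1 (α.head i).1 :=
      ⟨hi, α.isLink_tail_head i⟩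
    rcases Sym2.eq_iff.1 h with ⟨h1, h2⟩ | ⟨h1, h2⟩
    · have h1 := congrArg Subtype.val h1
      have h2 := congrArg Subtype.val h2
      simp only [v] at h1 h2
      rw [h1, h2] at hi'
      exact Graph.IsLink.eq hi' hj'
    · have h1 := congrArg Subtype.val h1
      have h2 := congrArg Subtype.val h2
      simp only [v] at h1 h2
      rw [h1, h2] at hi'
      exact Graph.IsLink.eq hi' hj'.symm
  exact ⟨fun h' => SimpleGraph.Reachable.trans h' h.reachable,
    fun h' => SimpleGraph.Reachable.trans h' h.symm.reachable⟩

/-- A cycle without flow outside of a spanning tree has no flow. -/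
theorem flow_eq_zero_of_isSpanningTree [Finite E] {z : p.Pos → ℤ} (hz : z ∈ α.edgeCycles)
    (h : ∀ i ∉ T, α.flow i z = 0) (i : E) : α.flow i z = 0 := by
  by_cases hi : i ∈ T
  · obtain ⟨W, h1, h2, h3⟩ := α.exists_cut hT hi
    refine α.flow_eq_zero_of_cut hz W h1 h2 fun j hj => ?_
    by_cases hjT : j ∈ T
    · exact Or.inr (h3 j hjT hj)
    · exact Or.inl (h j hjT)
  · exact h i hi

/-- The tree path from the word of the head of `e_i` to the word of its tail is closed up by `e_i`
itself. It visits every word at most once, so there is at most one arc on each circle. -/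
theorem exists_isAssociated {i : E} (hi : ∃ n, p.IsSingle n i) : ∃ d, α.IsAssociated T i d := by
  rw [α.exists_isSingle_iff] at hi
  let G := (p.wordGraph.restrict T).toSimpleGraph
  let v (n : Fin N) : (p.wordGraph.restrict T).vertexSet := ⟨n, Set.mem_univ n⟩
  obtain ⟨q, hq⟩ := hT.2.connected.exists_isPath (v (α.head i).1) (v (α.tail i).1)
  have hpos : 0 < q.length := by
    rw [Nat.pos_iff_ne_zero]
    intro h
    exact hi (congrArg Subtype.val (SimpleGraph.Walk.eq_of_length_eq_zero h)).symm
  have hstep : ∀ k, ∃ x y : p.Pos, k < q.length → p.letter x = p.letter y ∧ p.letter y ∈ T ∧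
      x.1 = (q.getVert k).1 ∧ y.1 = (q.getVert (k + 1)).1 := by
    intro k
    by_cases hk : k < q.length
    · obtain ⟨-, j, hj, x, y, -, hx, hy, hx', hy'⟩ := q.adj_getVert_succ hk
      exact ⟨x, y, fun _ => ⟨hx.trans hy.symm, hy ▸ hj, hx', hy'⟩⟩
    -- Dummy values beyond the end of the path.
    · exact ⟨α.tail i, α.tail i, fun h => absurd h hk⟩
  choose x y hxy using hstep
  -- One arc for each vertex of the path. Arc `m` runs from `y (m - 1)` to `x m`, except that arc 0
  -- begins at the head and the last arc ends at the tail of `e_i`.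
  let M := q.length + 1
  let σ : ZMod M → Fin N := fun m => (q.getVert m.val).1
  have hval : ∀ m : ZMod M, m.val ≤ q.length := fun m => Nat.lt_succ_iff.1 (ZMod.val_lt m)
  have ha : ∀ m : ZMod M, ∃ a : ZMod (p.len (σ m)), (m = 0 → (⟨σ m, a⟩ : p.Pos) = α.head i) ∧
      (m ≠ 0 → (⟨σ m, a⟩ : p.Pos) = y (m.val - 1)) := by
    intro m
    by_cases hm : m = 0
    · subst hm
      obtain ⟨a, ha⟩ := p.exists_eq_mk (x := α.head i) (n := σ 0) (by simp [σ, v])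
      exact ⟨a, fun _ => ha, fun h => absurd rfl h⟩
    · have h0 : m.val ≠ 0 := fun h => hm ((ZMod.val_eq_zero m).1 h)
      have h1 := hval m
      obtain ⟨a, ha⟩ := p.exists_eq_mk (x := y (m.val - 1)) (n := σ m) (by
        have := (hxy (m.val - 1) (by omega)).2.2.2
        rwa [Nat.sub_add_cancel (by omega)] at this)
      exact ⟨a, fun h => absurd h hm, fun _ => ha⟩
  have hb : ∀ m : ZMod M, ∃ b : ZMod (p.len (σ m)), (m.val = q.length →
      (⟨σ m, b⟩ : p.Pos) = α.tail i) ∧ (m.val ≠ q.length → (⟨σ m, b⟩ : p.Pos) = x m.val) := by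
    intro m
    by_cases hm : m.val = q.length
    · obtain ⟨a, ha⟩ := p.exists_eq_mk (x := α.tail i) (n := σ m) (by simp [σ, v, hm])
      exact ⟨a, fun _ => ha, fun h => absurd hm h⟩
    · have h1 := hval m
      obtain ⟨a, ha⟩ := p.exists_eq_mk (x := x m.val) (n := σ m) (hxy _ (by omega)).2.2.1
      exact ⟨a, fun h => absurd h hm, fun _ => ha⟩
  choose a ha0 ha1 using ha
  choose b hb0 hb1 using hb
  have hσ : Function.Injective σ := by
    intro m m' h
    exact ZMod.val_injective M (hq.getVert_injOn (hval m) (hval m') (Subtype.ext h))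
  -- Injectivity of `σ` makes the arc on the circle `n` well defined.
  have harc : ∀ n, ∃ o : Option (ZMod (p.len n) × ZMod (p.len n)),
      (∀ m, ∀ h : σ m = n, o = some (h ▸ a m, h ▸ b m)) ∧ (n ∉ Set.range σ → o = none) := by
    intro n
    by_cases hn : n ∈ Set.range σ
    · obtain ⟨m, rfl⟩ := hn
      refine ⟨some (a m, b m), fun m' h => ?_, fun h => absurd ⟨m, rfl⟩ h⟩
      obtain rfl := hσ h
      rfl
    · exact ⟨none, fun m h => absurd ⟨m, h⟩ hn, fun _ => rfl⟩
  choose arc harc0 harc1 using harc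
  have val_add_one : ∀ {m : ZMod M}, m.val < q.length → (m + 1).val = m.val + 1 := by
    intro m hm
    have h1 : (1 : ZMod M).val = 1 := ZMod.val_one'' (by omega)
    rw [ZMod.val_add_of_lt (by rw [h1]; omega), h1]
  have hneg : (-1 : ZMod M).val = q.length := ZMod.val_neg_one q.length
  have hcyc : p.IsCyclicArrangement arc M σ a b := by
    refine ⟨by omega, hσ, fun m => harc0 _ m rfl, harc1, fun m => ?_⟩
    change p.letter ⟨_, a (m + 1)⟩ = p.letter ⟨_, b m⟩
    by_cases hm : m.val = q.length
    · have h1 : m + 1 = 0 := by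
        rw [ZMod.val_injective M (hm.trans hneg.symm), neg_add_cancel]
      rw [ha0 _ h1, hb0 _ hm, α.letter_head, α.letter_tail]
    · have h0 := hval m
      have h1 : (m + 1).val = m.val + 1 := val_add_one (by omega)
      have h2 : m + 1 ≠ 0 := by
        intro h
        rw [h, ZMod.val_zero] at h1
        omega
      rw [ha1 _ h2, hb1 _ hm, h1, Nat.add_sub_cancel, (hxy m.val (by omega)).1]
  refine ⟨⟨arc, M, σ, a, b, hcyc⟩, M, σ, a, b, hcyc, (hb0 _ hneg).symm, (ha0 0 rfl).symm, ?_⟩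
  intro m hm
  change p.letter ⟨_, a m⟩ ∈ T
  have h0 : m.val ≠ 0 := fun h => hm ((ZMod.val_eq_zero m).1 h)
  have h1 := hval m
  rw [ha1 _ hm]
  exact (hxy (m.val - 1) (by omega)).2.1

end SpanningTree

end VirtualString

/-! ### The basis of the cycles and of the homology -/

namespace VirtualString

variable {E : Type} {N : ℕ} {p : GaussParagraph E N} (α : VirtualString p)

section Cycles

variable {T : Set E} {κ : Type} [Fintype κ] {v : Fin N ⊕ κ → p.Pos → ℤ} {lbl : κ → E} {ε : κ → ℤ}

open Classical in
-- The flow on `lbl k` isolates the coefficient of the member `k`; the circles that remain are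
-- separated by their values at the positions 0.
theorem linearIndependent_cycles (hlbl : Function.Injective lbl) (hlblT : ∀ k, lbl k ∉ T)
    (hε : ∀ k, IsUnit (ε k)) (hv : ∀ n, v (Sum.inl n) = p.circleVec n)
    (hflow : ∀ k, ∀ j ∉ T, α.flow j (v (Sum.inr k)) = if j = lbl k then ε k else 0) :
    LinearIndependent ℤ v := by
  rw [Fintype.linearIndependent_iff]
  intro g hg
  rw [Fintype.sum_sum_type] at hg
  have h0 : ∀ k, g (Sum.inr k) = 0 := by
    intro k
    have h := congrArg (α.flow (lbl k)) hg
    rw [map_add, map_sum, map_sum, map_zero, Finset.sum_eq_zero, zero_add,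
      Finset.sum_eq_single k, map_smul, hflow _ _ (hlblT k), if_pos rfl, smul_eq_mul,
      mul_eq_zero] at h
    · exact h.resolve_right (hε k).ne_zero
    · intro l _ hl
      rw [map_smul, hflow _ _ (hlblT k), if_neg (fun h => hl (hlbl h).symm), smul_zero]
    · simp
    · intro n _
      rw [map_smul, hv, flow_apply, p.jump_circleVec, Pi.zero_apply, smul_zero]
  have h1 : ∀ n, g (Sum.inl n) = 0 := by
    intro m
    have h := congrFun hg ⟨m, 0⟩
    simpa [h0, hv, Finset.sum_apply, p.circleVec_zero] using h
  rintro (n | k)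
  · exact h1 n
  · exact h0 k

open Classical in
theorem edgeCycles_le_span [Finite E] (hT : p.IsSpanningTree T) (hlbl : Function.Injective lbl)
    (hlblT : ∀ j ∉ T, ∃ k, lbl k = j)
    (hε : ∀ k, IsUnit (ε k)) (hv : ∀ n, v (Sum.inl n) = p.circleVec n)
    (hvZ : ∀ k, v (Sum.inr k) ∈ α.edgeCycles)
    (hflow : ∀ k, ∀ j ∉ T, α.flow j (v (Sum.inr k)) = if j = lbl k then ε k else 0) :
    α.edgeCycles ≤ Submodule.span ℤ (Set.range v) := by
  intro z hz
  -- `u` has the same flow as `z` outside `T`, since each unit `ε k` is its own inverse. The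
  -- difference then has no flow at all and is a combination of circles.
  let u := ∑ k, (α.flow (lbl k) z * ε k) • v (Sum.inr k)
  have hu : u ∈ Submodule.span ℤ (Set.range v) :=
    Submodule.sum_mem _ fun k _ => Submodule.smul_mem _ _ (Submodule.subset_span ⟨_, rfl⟩)
  have hw : z - u ∈ α.edgeCycles :=
    Submodule.sub_mem _ hz (Submodule.sum_mem _ fun k _ => Submodule.smul_mem _ _ (hvZ k))
  have hw0 : ∀ j ∉ T, α.flow j (z - u) = 0 := by
    intro j hj
    obtain ⟨k, rfl⟩ := hlblT j hj
    rw [map_sub, map_sum, Finset.sum_eq_single k, map_smul, hflow _ _ hj, if_pos rfl, smul_eq_mul,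
      mul_assoc, Int.isUnit_mul_self (hε k), mul_one, sub_self]
    · intro l _ hl
      rw [map_smul, hflow _ _ hj, if_neg (fun h => hl (hlbl h).symm), smul_zero]
    · simp
  have hw1 := p.eq_sum_circleVec
    (α.jump_eq_zero hw (α.flow_eq_zero_of_isSpanningTree hT hw hw0))
  have hw2 : z - u ∈ Submodule.span ℤ (Set.range v) := by
    rw [hw1]
    exact Submodule.sum_mem _ fun n _ =>
      Submodule.smul_mem _ _ (Submodule.subset_span ⟨Sum.inl n, hv n⟩)
  have := Submodule.add_mem _ hw2 hu
  rwa [sub_add_cancel] at this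

end Cycles

theorem edgeChain_sum_smul {ι : Type} [Fintype ι] (b : ι → H1 α.Surface) (v : ι → p.Pos → ℤ)
    (h : ∀ i, α.edgeChain (v i) = homologyInclusion α.Surface (b i)) (g : ι → ℤ) :
    α.edgeChain (∑ i, g i • v i) =
      homologyInclusion α.Surface (Fintype.linearCombination ℤ b g) := by
  refine (map_sum α.edgeChain _ _).trans (Eq.trans ?_ (map_sum (homologyInclusion α.Surface) _ _).symm)
  refine Finset.sum_congr rfl fun i _ => ?_
  rw [map_zsmul, h]
  refine Eq.trans ?_ ((homologyInclusion α.Surface).map_smul (g i) (b i)).symm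
  exact (int_smul_eq_zsmul _ _ _).symm

/-- A family of homology classes which are represented by a basis of the cycles is a basis. -/
theorem exists_basis_of_cycles [Finite E] {ι : Type} [Fintype ι] (b : ι → H1 α.Surface)
    (v : ι → p.Pos → ℤ) (h : ∀ i, α.edgeChain (v i) = homologyInclusion α.Surface (b i))
    (hli : LinearIndependent ℤ v) (hsp : α.edgeCycles ≤ Submodule.span ℤ (Set.range v)) :
    ∃ B : Module.Basis ι ℤ (H1 α.Surface), ∀ i, B i = b i := by
  have h1 : LinearIndependent ℤ b := by
    rw [Fintype.linearIndependent_iff] at hli ⊢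
    intro g hg
    have hg : Fintype.linearCombination ℤ b g = 0 := hg
    refine hli g (α.edgeChain_injective ?_)
    rw [α.edgeChain_sum_smul b v h, hg, map_zero, map_zero]
  have h2 : ⊤ ≤ Submodule.span ℤ (Set.range b) := by
    intro c _
    obtain ⟨z, hz⟩ := α.exists_edgeChain_eq c
    obtain ⟨g, rfl⟩ := (Submodule.mem_span_range_iff_exists_fun ℤ).1 (hsp (α.mem_edgeCycles hz))
    rw [α.edgeChain_sum_smul b v h] at hz
    exact (Submodule.mem_span_range_iff_exists_fun ℤ).2 ⟨g, homologyInclusion_injective hz⟩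
  exact ⟨Module.Basis.mk h1 h2, fun i => Module.Basis.mk_apply h1 h2 i⟩

theorem exists_basis [Finite E] {T : Set E} (hT : p.IsSpanningTree T)
    (d : {i // (∃ n, p.IsSingle n i) ∧ i ∉ T} → p.CyclicSequence)
    (hd : ∀ i, α.IsAssociated T i.1 (d i)) :
    ∃ B : Module.Basis
        (Fin N ⊕ {i // ∃ n, p.IsDouble n i} ⊕ {i // (∃ n, p.IsSingle n i) ∧ i ∉ T})
        ℤ (H1 α.Surface),
      (∀ n, B (Sum.inl n) = α.circleClass n) ∧
      (∀ i, B (Sum.inr (Sum.inl i)) = α.arrowClass i.1 i.2) ∧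
      (∀ i, B (Sum.inr (Sum.inr i)) = α.cyclicClass (d i)) := by
  classical
  have := Fintype.ofFinite E
  choose v₁ hv₁ hv₁j using fun i : {i // ∃ n, p.IsDouble n i} => α.exists_arrowVec i.1 i.2
  choose v₂ hv₂ hv₂f using fun i => α.flow_of_isAssociated (hd i)
  let lbl : {i // ∃ n, p.IsDouble n i} ⊕ {i // (∃ n, p.IsSingle n i) ∧ i ∉ T} → E :=
    Sum.elim Subtype.val Subtype.val
  -- The loop of a double letter runs from tail to head and jumps back, against the arrow; a cyclic
  -- sequence passes the arrow forwards.
  let ε : {i // ∃ n, p.IsDouble n i} ⊕ {i // (∃ n, p.IsSingle n i) ∧ i ∉ T} → ℤ :=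
    Sum.elim (fun _ => -1) (fun _ => 1)
  have hlbl : Function.Injective lbl := by
    refine Function.Injective.sumElim Subtype.val_injective Subtype.val_injective fun i j h => ?_
    exact (α.exists_isSingle_iff j.1).1 j.2.1 (h ▸ (α.exists_isDouble_iff i.1).1 i.2)
  have hlblT : ∀ k, lbl k ∉ T := by
    rintro (i | i) h
    · exact α.tail_fst_ne_head_fst_of_mem hT h ((α.exists_isDouble_iff i.1).1 i.2)
    · exact i.2.2 h
  have hlblT' : ∀ j ∉ T, ∃ k, lbl k = j := by
    intro j hj
    by_cases h : (α.tail j).1 = (α.head j).1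
    · exact ⟨Sum.inl ⟨j, (α.exists_isDouble_iff j).2 h⟩, rfl⟩
    · exact ⟨Sum.inr ⟨j, (α.exists_isSingle_iff j).2 h, hj⟩, rfl⟩
  have hε : ∀ k, IsUnit (ε k) := by
    rintro (i | i)
    · exact isUnit_one.neg
    · exact isUnit_one
  have hflow : ∀ k, ∀ j ∉ T, α.flow j (Sum.elim v₁ v₂ k) = if j = lbl k then ε k else 0 := by
    rintro (i | i) j hj
    · change α.flow j (v₁ i) = if j = i.1 then -1 else 0
      rw [flow_apply, hv₁j, Pi.sub_apply, Pi.single_eq_of_ne (α.tail_ne_head' i.1 j).symm,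
        zero_sub]
      split_ifs with h
      · rw [h, Pi.single_eq_same]
      · rw [Pi.single_eq_of_ne (fun h' => h (α.head_injective h')), neg_zero]
    · exact hv₂f i j hj
  have hclass : ∀ k, α.edgeChain (Sum.elim p.circleVec (Sum.elim v₁ v₂) k) =
      homologyInclusion α.Surface (Sum.elim α.circleClass
        (Sum.elim (fun i => α.arrowClass i.1 i.2) (fun i => α.cyclicClass (d i))) k) := by
    rintro (n | i | i)
    · exact (α.homologyInclusion_circleClass n).symm
    · exact hv₁ i
    · exact hv₂ i
  obtain ⟨B, hB⟩ := α.exists_basis_of_cycles _ _ hclass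
    (α.linearIndependent_cycles hlbl hlblT hε (fun _ => rfl) hflow)
    (α.edgeCycles_le_span hT hlbl hlblT' hε (fun _ => rfl)
      (fun k => α.mem_edgeCycles (hclass (Sum.inr k))) hflow)
  exact ⟨B, fun n => hB _, fun i => hB _, fun i => hB _⟩

end VirtualString
end

theorem lemmaL {E : Type} [Finite E] {N : ℕ} (p : GaussParagraph E N) (P : p.WordwisePartition)
    (h_i : p.EvenPSets) (h_iii : p.EvenCommon) (h_v : P.Compatible)
    (α : VirtualString p) (hα : α.Induces P) :
    Nontrivial (H1 α.Surface) ∧ Module.Free ℤ (H1 α.Surface) ∧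
    (∃ T, p.IsSpanningTree T) ∧
    ∀ T : Set E, p.IsSpanningTree T →
      (∀ i, (∃ n, p.IsSingle n i) → i ∉ T → ∃ d, α.IsAssociated T i d) ∧
      ∀ d : {i // (∃ n, p.IsSingle n i) ∧ i ∉ T} → p.CyclicSequence,
        (∀ i, α.IsAssociated T i.1 (d i)) →
        ∃ B : Module.Basis
            (Fin N ⊕ {i // ∃ n, p.IsDouble n i} ⊕ {i // (∃ n, p.IsSingle n i) ∧ i ∉ T})
            ℤ (H1 α.Surface),
          (∀ n, B (Sum.inl n) = α.circleClass n) ∧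
          (∀ i, B (Sum.inr (Sum.inl i)) = α.arrowClass i.1 i.2) ∧
          (∀ i, B (Sum.inr (Sum.inr i)) = α.cyclicClass (d i)) := by
  obtain ⟨T, hT⟩ := p.exists_isSpanningTree
  choose d hd using fun i : {i // (∃ n, p.IsSingle n i) ∧ i ∉ T} => α.exists_isAssociated hT i.2.1
  obtain ⟨B, -⟩ := α.exists_basis hT d hd
  -- There is at least one word, and the class of its circle is a nonzero basis element.
  refine ⟨⟨B (Sum.inl ⟨0, p.pos_N⟩), 0, B.ne_zero _⟩, Module.Free.of_basis B, ⟨T, hT⟩, fun T hT => ?_⟩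
  exact ⟨fun i hi _ => α.exists_isAssociated hT hi, fun d hd => α.exists_basis hT d hd⟩
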